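/- Let $n\ge 1$ and consider the $n\times n$ input-queued switch in discrete time, with queue lengths $q(t)=(q_{ij}(t))_{1\le i,j\le n}\in\mathbb{Z}_{\ge 0}^{n\times n}$. In each time slot $t$ a schedule $s(t)$, a permutation matrix (perfect matching of inputs and outputs), is chosen on the basis of $q(t)$, arrivals $a(t)=(a_{ij}(t))$ occur, independent of the past and of $s(t)$, and $$q_{ij}(t+1)=\max\{q_{ij}(t)+a_{ij}(t)-s_{ij}(t),0\}.$$ The scheduling algorithm is MaxWeight: $s(t)$ is always a permutation matrix maximizing $\langle q(t),s\rangle=\sum_{ij}q_{ij}(t)s_{ij}$, ties being broken by an arbitrary fixed, possibly randomized, rule that depends only on $q(t)$ (for instance uniformly at random). For $0<\varepsilon<1$ the traffic is uniform Bernoulli, completely saturating as $\varepsilon\downarrow0$: the $a_{ij}(t)$ are independent over $i,j,t$, take values in $\{0,1\}$, and have mean $\lambda^{(\varepsilon)}_{ij}=(1-\varepsilon)/n$ for all $i,j$. Then for every $\varepsilon\in(0,1)$ the Markov chain $q^{(\varepsilon)}(t)$ has a unique steady-state law: a stationary law to which, from every initial state, $q^{(\varepsilon)}(t)$ converges in distribution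 as $t\to\infty$. A random matrix $\overline q^{(\varepsilon)}$ with this law satisfies $\mathbb{E}\big[\sum_{ij}\overline q^{(\varepsilon)}_{ij}\big]<\infty$, and $$\lim_{\varepsilon\downarrow 0}\ \varepsilon\,\mathbb{E}\Big[\sum_{ij}\overline q^{(\varepsilon)}_{ij}\Big]=\frac{2n-1}{2}\Big(1-\frac1n\Big).$$ -/

import Mathlib

open Filter Topology MeasureTheory

noncomputable section

namespace Switch

/-- Queue lengths of an `n × n` input-queued switch: `q i j` is the number of packets waiting at
input port `i` for output port `j`. -/
abbrev QueueState (n : ℕ) : Type := Fin n → Fin n → ℕ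

/-- The packets arriving in one time slot under Bernoulli traffic: `a i j = true` when one packet
for output `j` arrives at input `i`, and `a i j = false` when none does. -/
abbrev Arrivals (n : ℕ) : Type := Fin n → Fin n → Bool

/-- A (maximal) schedule is a perfect matching between inputs and outputs, that is, a permutation:
input `i` is connected to output `s i`. -/
abbrev Schedule (n : ℕ) : Type := Equiv.Perm (Fin n)

theorem arrival_weights_sum {n : ℕ} (rate : Fin n → Fin n → unitInterval) :
    ∑ a : Arrivals n, ∏ i, ∏ j,
      ENNReal.ofReal (if a i j then (rate i j : ℝ) else 1 - (rate i j : ℝ)) = 1 := by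
  have row : ∀ i : Fin n, ∑ b : Fin n → Bool, ∏ j,
      ENNReal.ofReal (if b j then (rate i j : ℝ) else 1 - (rate i j : ℝ)) = 1 := by
    intro i
    have h := Fintype.prod_sum (fun (j : Fin n) (c : Bool) =>
      ENNReal.ofReal (if c then (rate i j : ℝ) else 1 - (rate i j : ℝ)))
    rw [← h]
    refine Finset.prod_eq_one fun j _ => ?_
    rw [Fintype.sum_bool]
    have h0 := (rate i j).2.1
    have h1 := (rate i j).2.2
    rw [← ENNReal.ofReal_add (by simpa using h0) (by simpa using h1)]
    simp
  have h := Fintype.prod_sum (fun (i : Fin n) (b : Fin n → Bool) =>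
    ∏ j, ENNReal.ofReal (if b j then (rate i j : ℝ) else 1 - (rate i j : ℝ)))
  rw [← h]
  exact Finset.prod_eq_one fun i _ => row i

/-- The law of the arrivals in one time slot: independent Bernoulli variables, the one for the
pair `(i, j)` having mean `rate i j`. -/
def arrivalLaw {n : ℕ} (rate : Fin n → Fin n → unitInterval) : PMF (Arrivals n) :=
  PMF.ofFintype
    (fun a => ∏ i, ∏ j,
      ENNReal.ofReal (if a i j then (rate i j : ℝ) else 1 - (rate i j : ℝ)))
    (arrival_weights_sum rate)

/-- The weight `⟨q, s⟩` of the schedule `s` when the queue lengths are `q`. -/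
def weight {n : ℕ} (q : QueueState n) (s : Schedule n) : ℕ := ∑ i, q i (s i)

/-- A scheduling policy chooses a schedule, possibly at random, from the current queue lengths.
It is a MaxWeight policy when it always chooses a schedule of maximum weight; the way in which
ties are broken is arbitrary. -/
def IsMaxWeight {n : ℕ} (policy : QueueState n → PMF (Schedule n)) : Prop :=
  ∀ q, ∀ s ∈ (policy q).support, ∀ s' : Schedule n, weight q s' ≤ weight q s

/-- The queue lengths in the next slot, `[q + a - s]⁺`. The subtraction is the truncated one of
the natural numbers, which is the positive part. -/
def nextQueue {n : ℕ} (q : QueueState n) (a : Arrivals n) (s : Schedule n) : QueueState n :=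
  fun i j => (q i j + (if a i j then 1 else 0)) - (if s i = j then 1 else 0)

/-- The one-step transition law of the queue length Markov chain: the schedule is chosen from the
current queue lengths, and the arrivals are drawn independently of the past and of the schedule. -/
def step {n : ℕ} (rate : Fin n → Fin n → unitInterval)
    (policy : QueueState n → PMF (Schedule n)) (q : QueueState n) : PMF (QueueState n) :=
  (policy q).bind fun s => (arrivalLaw rate).map fun a => nextQueue q a s

/-- The law at time `t` of the Markov chain with transition law `K` started at `x`. -/
def lawAt {α : Type*} (K : α → PMF α) (x : α) : ℕ → PMF α
  | 0 => PMF.pure x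
  | t + 1 => (lawAt K x t).bind K

/-- The probability measure on the space of queue lengths given by a mass function. -/
def toProb {n : ℕ} (p : PMF (QueueState n)) : ProbabilityMeasure (QueueState n) :=
  ⟨p.toMeasure, inferInstance⟩

/-- `p` is the steady-state law of the chain with transition law `K`: it is stationary, and from
every initial state the chain converges in distribution (weakly) to `p`. -/
structure IsSteadyState {n : ℕ} (K : QueueState n → PMF (QueueState n))
    (p : PMF (QueueState n)) : Prop where
  stationary : p.bind K = p
  tendsto : ∀ q : QueueState n,
    Tendsto (fun t => toProb (lawAt K q t)) atTop (𝓝 (toProb p))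

/-- The total queue length `∑ᵢⱼ qᵢⱼ`. -/
def totalQueue {n : ℕ} (q : QueueState n) : ℝ := ∑ i, ∑ j, (q i j : ℝ)

/-- The uniform arrival rates `λᵢⱼ = (1 - ε) / n`, for `0 < ε < 1`. -/
def uniformRate (n : ℕ) (ε : Set.Ioo (0 : ℝ) 1) : Fin n → Fin n → unitInterval :=
  fun i _ => ⟨(1 - (ε : ℝ)) / n, by
    have h0 := ε.2.1
    have h1 := ε.2.2
    have hn : (1 : ℝ) ≤ n := by exact_mod_cast i.pos
    constructor
    · apply div_nonneg <;> linarith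
    · rw [div_le_one (by linarith)]
      linarith⟩

end Switch

end

/-! Write `T` for the total queue length, `r = (1 - ε) / n` for the common rate, `u` for the unused
service of a slot and `q⁺` for the next state. The Lyapunov function is `marginForm`, which is `n`
times the squared norm of the component of `q` in the span of the row and column indicators; `perp`
is the complementary component. Every schedule has all row and column sums equal to 1, so the linear
part of the drift of `marginForm` is `-2 ε T`, whatever the schedule, and the arrival variance gives
an explicit constant (`mean_marginInner`, `mean_marginForm`). In steady state the total drift
vanishes, and this determines `2 ε E[T]` up to the terms in which `u` occurs.

Those terms are small. Service is unused only at queues that are empty in `q⁺`, so `u` and `q⁺` are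
orthogonal and their margin inner product reduces to `-n ⟨u, perp q⁺⟩` (`marginInner_of_disjoint`).
The weighted AM-GM inequality bounds the error by `(n/η + n) E[∑ u] + n η E‖perp q‖²`
(`abs_idle_le`). Stationarity of `T` gives `E[∑ u] = n ε`, so with `η = √ε` the error tends to 0 as
soon as `E‖perp q‖²` is bounded uniformly in `ε`.

That uniform bound (state space collapse) is `rootDrift_perp`. If `M` is the maximum weight, two
facts about permutations give `‖perp q‖²` a drift of at most `-(2r/n²) ‖perp q‖ + n²`: the gap `n M
- T` controls `‖perp q‖` (`sqrt_sqSum_perp_le`), and `perp q` has a nonnegative sum over the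
nonempty queues that are served (`served_perp_nonneg`). The coefficient involves `r` and not the
slack `ε`, so it survives the limit.

The steady state exists because `‖q‖²` has negative drift below capacity: time averages of the laws
have a limit along an ultrafilter, and that limit is an invariant law (`exists_stationary`).
Convergence from every initial state comes from two independent copies that eventually meet
(`tendsto_unmet`). The construction also turns each drift condition `RootDrift` into a stationary
moment bound (`RootDrift.sq_drift`), and uniqueness transfers these bounds to any steady state. -/

noncomputable section

namespace Switch

open scoped ENNReal

variable {α β : Type*}

/-! ### Expectations under a probability mass function -/

/-- The expectation of an extended nonnegative function. -/
def lmean (p : PMF α) (f : α → ℝ≥0∞) : ℝ≥0∞ := ∑' x, p x * f x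

/-- The expectation of a real function. -/
def mean (p : PMF α) (f : α → ℝ) : ℝ := ∑' x, (p x).toReal * f x

theorem lmean_bind (p : PMF α) (k : α → PMF β) (f : β → ℝ≥0∞) :
    lmean (p.bind k) f = lmean p fun x => lmean (k x) f := by
  simp only [lmean, PMF.bind_apply, ← ENNReal.tsum_mul_right, ← ENNReal.tsum_mul_left]
  rw [ENNReal.tsum_comm]
  simp only [mul_assoc]

theorem lmean_pure (x : α) (f : α → ℝ≥0∞) : lmean (PMF.pure x) f = f x := by
  rw [lmean, tsum_eq_single x]
  · simp
  · intro y hy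
    simp [PMF.pure_apply, hy]

theorem lmean_mono (p : PMF α) {f g : α → ℝ≥0∞} (h : ∀ x, f x ≤ g x) : lmean p f ≤ lmean p g :=
  ENNReal.tsum_le_tsum fun x => mul_le_mul_right (h x) _

theorem lmean_add (p : PMF α) (f g : α → ℝ≥0∞) :
    lmean p (fun x => f x + g x) = lmean p f + lmean p g := by
  simp only [lmean, mul_add, ENNReal.tsum_add]

theorem lmean_const (p : PMF α) (c : ℝ≥0∞) : lmean p (fun _ => c) = c := by
  simp [lmean, ENNReal.tsum_mul_right, p.tsum_coe]

theorem summable_toReal (p : PMF α) : Summable fun x => (p x).toReal :=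
  ENNReal.summable_toReal p.tsum_coe_ne_top

theorem tsum_toReal (p : PMF α) : ∑' x, (p x).toReal = 1 := by
  rw [← ENNReal.tsum_toReal_eq (fun x => p.apply_ne_top x), p.tsum_coe]
  simp

theorem summable_mean_of_bounded (p : PMF α) {f : α → ℝ} {B : ℝ}
    (h : ∀ x ∈ p.support, |f x| ≤ B) : Summable fun x => (p x).toReal * f x := by
  refine Summable.of_norm_bounded (g := fun x => (p x).toReal * B)
    ((summable_toReal p).mul_right B) fun x => ?_
  by_cases hx : x ∈ p.support
  · rw [Real.norm_eq_abs, abs_mul, abs_of_nonneg ENNReal.toReal_nonneg]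
    exact mul_le_mul_of_nonneg_left (h x hx) ENNReal.toReal_nonneg
  · simp [(p.apply_eq_zero_iff x).2 hx]

theorem exists_bound_of_finite {s : Set α} (hs : s.Finite) (f : α → ℝ) :
    ∃ B, ∀ x ∈ s, |f x| ≤ B := by
  obtain ⟨B, hB⟩ := (hs.image fun x => |f x|).bddAbove
  exact ⟨B, fun x hx => hB ⟨x, hx, rfl⟩⟩

theorem summable_mean_of_finite {p : PMF α} (hp : p.support.Finite) (f : α → ℝ) :
    Summable fun x => (p x).toReal * f x :=
  let ⟨_, hB⟩ := exists_bound_of_finite hp f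
  summable_mean_of_bounded p hB

/-- Boundedness on the support makes the double series absolutely summable, which justifies
exchanging the two sums. -/
theorem mean_bind (p : PMF α) (k : α → PMF β) {f : β → ℝ} {B : ℝ}
    (h : ∀ y ∈ (p.bind k).support, |f y| ≤ B) :
    mean (p.bind k) f = mean p fun x => mean (k x) f := by
  have hsum : Summable (Function.uncurry fun (y : β) (x : α) =>
      (p x).toReal * (k x y).toReal * f y) := by
    have h1 : ∑' z : β × α, p z.2 * k z.2 z.1 ≠ ⊤ := by
      rw [ENNReal.tsum_prod', ENNReal.tsum_comm]
      simp [ENNReal.tsum_mul_left, PMF.tsum_coe]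
    refine Summable.of_norm_bounded ((ENNReal.summable_toReal h1).mul_right B) fun z => ?_
    obtain ⟨y, x⟩ := z
    simp only [Function.uncurry, ENNReal.toReal_mul]
    by_cases hx : p x * k x y = 0
    · rw [← ENNReal.toReal_mul, hx]
      simp
    · have hy : y ∈ (p.bind k).support := by
        rw [PMF.mem_support_bind_iff]
        exact ⟨x, left_ne_zero_of_mul hx, right_ne_zero_of_mul hx⟩
      rw [Real.norm_eq_abs, abs_mul, abs_of_nonneg (a := (p x).toReal * (k x y).toReal)
        (by positivity)]
      exact mul_le_mul_of_nonneg_left (h y hy) (by positivity)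
  have e1 : ∀ y, ((p.bind k) y).toReal * f y
      = ∑' x, (p x).toReal * (k x y).toReal * f y := by
    intro y
    rw [PMF.bind_apply, ENNReal.tsum_toReal_eq, ← tsum_mul_right]
    · simp only [ENNReal.toReal_mul]
    · exact fun x => ENNReal.mul_ne_top (p.apply_ne_top x) ((k x).apply_ne_top y)
  simp only [mean, e1, ← tsum_mul_left]
  simp only [← mul_assoc]
  exact (Summable.tsum_comm hsum).symm

theorem mean_pure (x : α) (f : α → ℝ) : mean (PMF.pure x) f = f x := by
  rw [mean, tsum_eq_single x]
  · simp
  · intro y hy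
    simp [PMF.pure_apply, hy]

theorem mean_map (p : PMF α) (g : α → β) {f : β → ℝ} {B : ℝ}
    (h : ∀ x ∈ p.support, |f (g x)| ≤ B) :
    mean (p.map g) f = mean p fun x => f (g x) := by
  rw [PMF.map, mean_bind (B := B)]
  · simp [mean_pure]
  · intro y hy
    have hy' : y ∈ (p.map g).support := hy
    rw [PMF.mem_support_map_iff] at hy'
    obtain ⟨x, hx, rfl⟩ := hy'
    exact h x hx

theorem mean_const (p : PMF α) (c : ℝ) : mean p (fun _ => c) = c := by
  rw [mean, tsum_mul_right, tsum_toReal, one_mul]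

theorem mean_mul_left (p : PMF α) (c : ℝ) (f : α → ℝ) :
    mean p (fun x => c * f x) = c * mean p f := by
  rw [mean, mean, ← tsum_mul_left]
  exact tsum_congr fun x => by ring

theorem mean_nonneg (p : PMF α) {f : α → ℝ} (h : ∀ x ∈ p.support, 0 ≤ f x) : 0 ≤ mean p f := by
  refine tsum_nonneg fun x => ?_
  by_cases hx : x ∈ p.support
  · exact mul_nonneg ENNReal.toReal_nonneg (h x hx)
  · simp [(p.apply_eq_zero_iff x).2 hx]

theorem mean_eq_sum {p : PMF α} (hp : p.support.Finite) (f : α → ℝ) :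
    mean p f = ∑ x ∈ hp.toFinset, (p x).toReal * f x := by
  refine tsum_eq_sum fun x hx => ?_
  rw [Set.Finite.mem_toFinset] at hx
  simp [(p.apply_eq_zero_iff x).2 hx]

theorem mean_add {p : PMF α} (hp : p.support.Finite) (f g : α → ℝ) :
    mean p (fun x => f x + g x) = mean p f + mean p g := by
  simp only [mean_eq_sum hp, mul_add, Finset.sum_add_distrib]

theorem mean_sub {p : PMF α} (hp : p.support.Finite) (f g : α → ℝ) :
    mean p (fun x => f x - g x) = mean p f - mean p g := by
  simp only [mean_eq_sum hp, mul_sub, Finset.sum_sub_distrib]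

theorem mean_mono {p : PMF α} (hp : p.support.Finite) {f g : α → ℝ}
    (h : ∀ x ∈ p.support, f x ≤ g x) : mean p f ≤ mean p g := by
  simp only [mean_eq_sum hp]
  refine Finset.sum_le_sum fun x hx => mul_le_mul_of_nonneg_left (h x ?_) ENNReal.toReal_nonneg
  simpa using hx

theorem abs_mean_le {p : PMF α} (hp : p.support.Finite) (f : α → ℝ) :
    |mean p f| ≤ mean p fun x => |f x| := by
  simp only [mean_eq_sum hp]
  refine (Finset.abs_sum_le_sum_abs _ _).trans (le_of_eq ?_)
  exact Finset.sum_congr rfl fun x _ => by rw [abs_mul, abs_of_nonneg ENNReal.toReal_nonneg]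

/-- Since `mean` takes the default value 0 on a series that is not summable, finiteness of moments
is proved for `lmean` and carried over to `mean` by this identity. -/
theorem ofReal_mean (p : PMF α) {f : α → ℝ} (h0 : ∀ x, 0 ≤ f x)
    (hs : Summable fun x => (p x).toReal * f x) :
    ENNReal.ofReal (mean p f) = lmean p fun x => ENNReal.ofReal (f x) := by
  rw [mean, ENNReal.ofReal_tsum_of_nonneg (fun x => mul_nonneg ENNReal.toReal_nonneg (h0 x)) hs]
  refine tsum_congr fun x => ?_
  rw [ENNReal.ofReal_mul ENNReal.toReal_nonneg, ENNReal.ofReal_toReal (p.apply_ne_top x)]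

/-! ### Strong maximum principle -/

/-- If a bounded subharmonic function attains its maximum at `z`, it takes the same value at every
state that can be reached in one step. -/
theorem eq_of_mean_ge {p : PMF α} (hp : p.support.Finite) {f : α → ℝ} {m : ℝ}
    (hf : ∀ x, f x ≤ m) (h : m ≤ mean p f) {y : α} (hy : y ∈ p.support) : f y = m := by
  by_contra hne
  have hlt : f y < m := lt_of_le_of_ne (hf y) hne
  have h1 : mean p f < mean p fun _ => m := by
    simp only [mean_eq_sum hp]
    refine Finset.sum_lt_sum
      (fun x _ => mul_le_mul_of_nonneg_left (hf x) ENNReal.toReal_nonneg) ⟨y, by simpa using hy, ?_⟩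
    refine mul_lt_mul_of_pos_left hlt (ENNReal.toReal_pos hy (p.apply_ne_top y))
  rw [mean_const] at h1
  linarith

/-- Maximum principle with a Lyapunov function: the drift of `V` outside `F` forces `D` to attain
its supremum in the finite set `F`, and the maximal value propagates along a path of positive
probability to `z₀`, where `D` vanishes. -/
theorem eq_zero_of_subharmonic {Q : β → PMF β} (hQ : ∀ z, (Q z).support.Finite)
    {D V : β → ℝ} {z₀ : β} {F : Set β} {h : β → ℕ} {B : ℝ}
    (hD0 : ∀ z, 0 ≤ D z) (hDB : ∀ z, D z ≤ B) (hD : ∀ z, D z ≤ mean (Q z) D) (hDz : D z₀ = 0)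
    (hV0 : ∀ z, 0 ≤ V z) (hVfin : ∀ M : ℝ, {z | V z ≤ M}.Finite) (hF : F.Finite)
    (hdrift : ∀ z ∉ F, mean (Q z) V ≤ V z - 1) (hz₀ : z₀ ∈ F)
    (hpath : ∀ z, z ≠ z₀ → ∃ z' ∈ (Q z).support, h z' < h z) (z : β) : D z = 0 := by
  obtain ⟨w, hwF, hw⟩ := hF.exists_maximalFor D F ⟨z₀, hz₀⟩
  have hw' : ∀ z ∈ F, D z ≤ D w := fun z hz => by
    by_contra hlt
    push Not at hlt
    exact absurd (hw hz hlt.le) (not_le.2 hlt)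
  -- A larger value would be attained, as the superlevel set is finite, and at a point outside `F`.
  -- There the mean of `D - κ V` after one step exceeds its present value by at least `κ`, which is
  -- impossible at a maximum.
  have key : ∀ κ : ℝ, 0 < κ → ∀ z, D z - κ * V z ≤ D w := by
    intro κ hκ z
    by_contra hlt
    push Not at hlt
    have hSfin : {y | V y ≤ B / κ ∧ D w < D y - κ * V y}.Finite :=
      (hVfin (B / κ)).subset fun y hy => hy.1
    have hmem : ∀ y, D w < D y - κ * V y → y ∈ {y | V y ≤ B / κ ∧ D w < D y - κ * V y} := by
      intro y hy
      refine ⟨?_, hy⟩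
      rw [le_div_iff₀ hκ]
      nlinarith [hDB y, hD0 w]
    obtain ⟨y, hy, hmax⟩ := hSfin.exists_maximalFor (fun y => D y - κ * V y) _ ⟨z, hmem z hlt⟩
    have hall : ∀ x, D x - κ * V x ≤ D y - κ * V y := by
      intro x
      by_cases hx : D w < D x - κ * V x
      · by_contra hlt
        push Not at hlt
        exact absurd (hmax (hmem x hx) hlt.le) (not_le.2 hlt)
      · exact (not_lt.1 hx).trans hy.2.le
    have hyF : y ∉ F := fun hyF => by
      have h1 := hw' y hyF
      have h2 := hy.2
      have h3 := mul_nonneg hκ.le (hV0 y)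
      linarith
    have h1 : mean (Q y) (fun x => D x - κ * V x) ≤ D y - κ * V y := by
      rw [← mean_const (Q y) (D y - κ * V y)]
      exact mean_mono (hQ y) fun x _ => hall x
    rw [mean_sub (hQ y), mean_mul_left] at h1
    have h2 := mul_le_mul_of_nonneg_left (hdrift y hyF) hκ.le
    have h3 := hD y
    nlinarith
  have hmax : ∀ z, D z ≤ D w := by
    intro z
    refine le_of_forall_pos_le_add fun e he => ?_
    have hpos : 0 < V z + 1 := by linarith [hV0 z]
    have h1 := key (e / (V z + 1)) (by positivity) z
    have h2 : e / (V z + 1) * V z ≤ e := by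
      rw [div_mul_eq_mul_div, div_le_iff₀ hpos]
      nlinarith
    linarith
  have hreach : ∀ k, ∀ z, h z ≤ k → D z = D w → D w = 0 := by
    intro k
    induction k with
    | zero =>
      intro z hz hzw
      by_cases hzz : z = z₀
      · rw [← hzw, hzz, hDz]
      · obtain ⟨z', _, hz'⟩ := hpath z hzz
        omega
    | succ k ih =>
      intro z hz hzw
      by_cases hzz : z = z₀
      · rw [← hzw, hzz, hDz]
      · obtain ⟨z', hs, hz'⟩ := hpath z hzz
        exact ih z' (by omega) (eq_of_mean_ge (hQ z) hmax (hzw ▸ hD z) hs)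
  have h0 := hreach (h w) w le_rfl rfl
  exact le_antisymm (h0 ▸ hmax z) (hD0 z)

/-! ### Convergence to a stationary law -/

theorem lawAt_succ' (K : α → PMF α) (x : α) (t : ℕ) :
    lawAt K x (t + 1) = (K x).bind fun y => lawAt K y t := by
  induction t with
  | zero => simp [lawAt]
  | succ t ih =>
    rw [lawAt, ih, PMF.bind_bind]
    rfl

theorem bind_lawAt {K : α → PMF α} {p : PMF α} (hp : p.bind K = p) (t : ℕ) :
    (p.bind fun x => lawAt K x t) = p := by
  induction t with
  | zero => simp [lawAt]
  | succ t ih =>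
    simp only [lawAt]
    rw [← PMF.bind_bind, ih, hp]

theorem abs_mean_le_of_bounded (p : PMF α) {f : α → ℝ} {B : ℝ} (h : ∀ x, |f x| ≤ B) :
    |mean p f| ≤ B := by
  have h1 : |mean p f| ≤ ∑' x, (p x).toReal * B := by
    refine tsum_of_norm_bounded (f := fun x => (p x).toReal * f x)
      ((summable_toReal p).mul_right B).hasSum fun x => ?_
    rw [Real.norm_eq_abs, abs_mul, abs_of_nonneg ENNReal.toReal_nonneg]
    exact mul_le_mul_of_nonneg_left (h x) ENNReal.toReal_nonneg
  rwa [tsum_mul_right, tsum_toReal, one_mul] at h1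

/-- Two independent copies of the chain with transition law `K`. -/
def pairKernel (K : α → PMF α) (z : α × α) : PMF (α × α) :=
  (K z.1).bind fun x => (K z.2).map fun y => (x, y)

theorem mem_support_pairKernel {K : α → PMF α} {z w : α × α} :
    w ∈ (pairKernel K z).support ↔ w.1 ∈ (K z.1).support ∧ w.2 ∈ (K z.2).support := by
  obtain ⟨w1, w2⟩ := w
  simp only [pairKernel, PMF.mem_support_bind_iff, PMF.mem_support_map_iff, Prod.mk.injEq]
  constructor
  · rintro ⟨x, hx, y, hy, rfl, rfl⟩
    exact ⟨hx, hy⟩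
  · rintro ⟨h1, h2⟩
    exact ⟨w1, h1, w2, h2, rfl, rfl⟩

theorem finite_support_pairKernel {K : α → PMF α} (hK : ∀ x, (K x).support.Finite) (z : α × α) :
    (pairKernel K z).support.Finite :=
  ((hK z.1).prod (hK z.2)).subset fun _ hw => Set.mem_prod.2 (mem_support_pairKernel.1 hw)

theorem mean_pairKernel {K : α → PMF α} (hK : ∀ x, (K x).support.Finite) (z : α × α)
    (f : α × α → ℝ) :
    mean (pairKernel K z) f = mean (K z.1) fun x => mean (K z.2) fun y => f (x, y) := by
  obtain ⟨B, hB⟩ := exists_bound_of_finite (finite_support_pairKernel hK z) f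
  rw [pairKernel, mean_bind _ _ hB]
  congr 1
  funext x
  obtain ⟨B', hB'⟩ := exists_bound_of_finite (hK z.2) fun y => f (x, y)
  rw [mean_map _ _ hB']

/-- A bound for the probability that two independent copies of the chain have not met. -/
def unmet (K : α → PMF α) : ℕ → α × α → ℝ
  | 0 => fun z => by classical exact if z.1 = z.2 then 0 else 1
  | t + 1 => fun z => by classical exact if z.1 = z.2 then 0 else mean (pairKernel K z) (unmet K t)

theorem unmet_diag (K : α → PMF α) (t : ℕ) (x : α) : unmet K t (x, x) = 0 := by
  cases t <;> simp [unmet]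

theorem unmet_nonneg (K : α → PMF α) (t : ℕ) (z : α × α) : 0 ≤ unmet K t z := by
  induction t generalizing z with
  | zero => unfold unmet; split_ifs <;> norm_num
  | succ t ih =>
    unfold unmet
    split_ifs
    · exact le_rfl
    · exact mean_nonneg _ fun w _ => ih w

theorem unmet_le_one {K : α → PMF α} (hK : ∀ x, (K x).support.Finite) (t : ℕ) (z : α × α) :
    unmet K t z ≤ 1 := by
  induction t generalizing z with
  | zero => unfold unmet; split_ifs <;> norm_num
  | succ t ih =>
    unfold unmet
    split_ifs
    · norm_num
    · rw [← mean_const (pairKernel K z) 1]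
      exact mean_mono (finite_support_pairKernel hK z) fun w _ => ih w

theorem unmet_succ_le {K : α → PMF α} (hK : ∀ x, (K x).support.Finite) (t : ℕ) (z : α × α) :
    unmet K (t + 1) z ≤ unmet K t z := by
  induction t generalizing z with
  | zero =>
    by_cases hz : z.1 = z.2
    · simp [unmet, hz]
    · have h := unmet_le_one hK 1 z
      simpa [unmet, hz] using h
  | succ t ih =>
    by_cases hz : z.1 = z.2
    · simp [unmet, hz]
    · rw [unmet, unmet]
      simp only [hz, if_false]
      exact mean_mono (finite_support_pairKernel hK z) fun w _ => ih w

/-- Coupling inequality: once the copies meet, their later laws coincide, so only the event of not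
having met contributes. -/
theorem abs_sub_le_unmet {K : α → PMF α} (hK : ∀ x, (K x).support.Finite) {f : α → ℝ} {B : ℝ}
    (hf : ∀ x, |f x| ≤ B) (t : ℕ) (z : α × α) :
    |mean (lawAt K z.1 t) f - mean (lawAt K z.2 t) f| ≤ 2 * B * unmet K t z := by
  induction t generalizing z with
  | zero =>
    by_cases hz : z.1 = z.2
    · simp [unmet, hz]
    · simp only [lawAt, mean_pure, unmet, hz, if_false, mul_one]
      have h1 := abs_le.1 (hf z.1)
      have h2 := abs_le.1 (hf z.2)
      rw [abs_le]
      constructor <;> linarith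
  | succ t ih =>
    by_cases hz : z.1 = z.2
    · simp [unmet, hz]
    · have e : mean (lawAt K z.1 (t + 1)) f - mean (lawAt K z.2 (t + 1)) f
          = mean (pairKernel K z)
            fun w => mean (lawAt K w.1 t) f - mean (lawAt K w.2 t) f := by
        rw [mean_sub (finite_support_pairKernel hK z), mean_pairKernel hK, mean_pairKernel hK,
          lawAt_succ', lawAt_succ', mean_bind _ _ fun y _ => hf y, mean_bind _ _ fun y _ => hf y]
        simp only [mean_const]
      rw [e]
      refine (abs_mean_le (finite_support_pairKernel hK z) _).trans ?_
      rw [unmet]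
      simp only [hz, if_false]
      rw [← mean_mul_left]
      exact mean_mono (finite_support_pairKernel hK z) fun w _ => ih w

/-- The decreasing limit of `unmet` is subharmonic for the pair chain and zero on the diagonal,
hence zero by `eq_zero_of_subharmonic`. The hypothesis `hstay` replaces aperiodicity. -/
theorem tendsto_unmet {K : α → PMF α} (hK : ∀ x, (K x).support.Finite)
    {V f : α → ℝ} {C : ℝ} (hV0 : ∀ x, 0 ≤ V x) (hf0 : ∀ x, 0 ≤ f x)
    (hVfin : ∀ M : ℝ, {x | V x ≤ M}.Finite) (hffin : ∀ M : ℝ, {x | f x ≤ M}.Finite)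
    (hdrift : ∀ x, mean (K x) V + f x ≤ V x + C) {x₀ : α} {h : α → ℕ}
    (hstay : x₀ ∈ (K x₀).support) (hpath : ∀ x, x ≠ x₀ → ∃ y ∈ (K x).support, h y < h x)
    (z : α × α) : Tendsto (fun t => unmet K t z) atTop (𝓝 0) := by
  have hlim : ∀ z, ∃ l, Tendsto (fun t => unmet K t z) atTop (𝓝 l) := fun z =>
    ⟨_, tendsto_atTop_ciInf (antitone_nat_of_succ_le fun t => unmet_succ_le hK t z)
      ⟨0, by rintro _ ⟨t, rfl⟩; exact unmet_nonneg K t z⟩⟩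
  choose D hD using hlim
  have hD0 : ∀ z, 0 ≤ D z := fun z => ge_of_tendsto' (hD z) fun t => unmet_nonneg K t z
  have hD1 : ∀ z, D z ≤ 1 := fun z => le_of_tendsto' (hD z) fun t => unmet_le_one hK t z
  have hDdiag : ∀ z : α × α, z.1 = z.2 → D z = 0 := by
    rintro ⟨x, y⟩ (rfl : x = y)
    refine tendsto_nhds_unique (hD (x, x)) ?_
    simp [unmet_diag]
  have hsub : ∀ z, D z ≤ mean (pairKernel K z) D := by
    intro z
    by_cases hz : z.1 = z.2
    · rw [hDdiag z hz]
      exact mean_nonneg _ fun w _ => hD0 w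
    · refine le_of_tendsto_of_tendsto' ((tendsto_add_atTop_iff_nat 1).2 (hD z))
        (g := fun t => mean (pairKernel K z) (unmet K t)) ?_ fun t => ?_
      · simp only [mean_eq_sum (finite_support_pairKernel hK z)]
        exact tendsto_finsetSum _ fun w _ => (hD w).const_mul _
      · rw [unmet]
        simp [hz]
  have hzero : D z = 0 := by
    refine eq_zero_of_subharmonic (finite_support_pairKernel hK) (V := fun z => V z.1 + V z.2)
      -- The two drifts add up to at most `2 C - (f z.1 + f z.2)`, which is below `-1` outside this
      -- set.
      (z₀ := (x₀, x₀)) (F := {z | f z.1 + f z.2 ≤ 2 * C + 1} ∪ {(x₀, x₀)})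
      (h := fun z => h z.1 + h z.2) hD0 hD1 hsub (hDdiag _ rfl)
      (fun z => add_nonneg (hV0 _) (hV0 _)) ?_ ?_ ?_ (Or.inr rfl) ?_ z
    · intro M
      refine ((hVfin M).prod (hVfin M)).subset fun z hz => ?_
      have h1 : V z.1 + V z.2 ≤ M := hz
      exact ⟨by have := hV0 z.2; change V z.1 ≤ M; linarith,
        by have := hV0 z.1; change V z.2 ≤ M; linarith⟩
    · refine Set.Finite.union (((hffin (2 * C + 1)).prod (hffin (2 * C + 1))).subset
        fun z hz => ?_) (Set.finite_singleton _)
      have h1 : f z.1 + f z.2 ≤ 2 * C + 1 := hz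
      exact ⟨by have := hf0 z.2; change f z.1 ≤ 2 * C + 1; linarith,
        by have := hf0 z.1; change f z.2 ≤ 2 * C + 1; linarith⟩
    · intro z hz
      have h1 : ¬ f z.1 + f z.2 ≤ 2 * C + 1 := fun h1 => hz (Or.inl h1)
      rw [mean_add (finite_support_pairKernel hK z), mean_pairKernel hK, mean_pairKernel hK]
      simp only [mean_const]
      have h2 := hdrift z.1
      have h3 := hdrift z.2
      linarith
    -- A copy that has reached `x₀` waits there while the other one descends.
    · rintro ⟨x, y⟩ hxy
      have hx : ∃ x' ∈ (K x).support, h x' ≤ h x ∧ (x ≠ x₀ → h x' < h x) := by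
        by_cases hx : x = x₀
        · exact ⟨x₀, by rw [hx]; exact hstay, by rw [hx], fun hne => absurd hx hne⟩
        · obtain ⟨x', h1, h2⟩ := hpath x hx
          exact ⟨x', h1, h2.le, fun _ => h2⟩
      have hy : ∃ x' ∈ (K y).support, h x' ≤ h y ∧ (y ≠ x₀ → h x' < h y) := by
        by_cases hx : y = x₀
        · exact ⟨x₀, by rw [hx]; exact hstay, by rw [hx], fun hne => absurd hx hne⟩
        · obtain ⟨x', h1, h2⟩ := hpath y hx
          exact ⟨x', h1, h2.le, fun _ => h2⟩
      obtain ⟨x', h1, h2, h3⟩ := hx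
      obtain ⟨y', h4, h5, h6⟩ := hy
      refine ⟨(x', y'), mem_support_pairKernel.2 ⟨h1, h4⟩, ?_⟩
      by_cases hx : x = x₀
      · have hy : y ≠ x₀ := fun hy => hxy (by rw [hx, hy])
        have := h6 hy
        simp only
        omega
      · have := h3 hx
        simp only
        omega
  exact hzero ▸ hD z

theorem tendsto_mean_lawAt {K : α → PMF α} (hK : ∀ x, (K x).support.Finite)
    {V f : α → ℝ} {C : ℝ} (hV0 : ∀ x, 0 ≤ V x) (hf0 : ∀ x, 0 ≤ f x)
    (hVfin : ∀ M : ℝ, {x | V x ≤ M}.Finite) (hffin : ∀ M : ℝ, {x | f x ≤ M}.Finite)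
    (hdrift : ∀ x, mean (K x) V + f x ≤ V x + C) {x₀ : α} {h : α → ℕ}
    (hstay : x₀ ∈ (K x₀).support) (hpath : ∀ x, x ≠ x₀ → ∃ y ∈ (K x).support, h y < h x)
    {p : PMF α} (hp : p.bind K = p) {g : α → ℝ} {B : ℝ} (hg : ∀ x, |g x| ≤ B) (x : α) :
    Tendsto (fun t => mean (lawAt K x t) g) atTop (𝓝 (mean p g)) := by
  have hdiff : ∀ y, Tendsto (fun t => mean (lawAt K y t) g - mean (lawAt K x t) g) atTop (𝓝 0) := by
    intro y
    refine squeeze_zero_norm (fun t => abs_sub_le_unmet hK hg t (y, x)) ?_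
    simpa using (tendsto_unmet hK hV0 hf0 hVfin hffin hdrift hstay hpath (y, x)).const_mul (2 * B)
  have hlim : Tendsto (fun t => mean p fun y => mean (lawAt K y t) g - mean (lawAt K x t) g) atTop
      (𝓝 (∑' _ : α, (0 : ℝ))) := by
    refine tendsto_tsum_of_dominated_convergence
      (bound := fun y => (p y).toReal * (2 * B)) ((summable_toReal p).mul_right _) ?_ ?_
    · intro y
      simpa using (hdiff y).const_mul (p y).toReal
    · refine Eventually.of_forall fun t y => ?_
      rw [Real.norm_eq_abs, abs_mul, abs_of_nonneg ENNReal.toReal_nonneg]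
      refine mul_le_mul_of_nonneg_left ?_ ENNReal.toReal_nonneg
      have h1 := abs_le.1 (abs_mean_le_of_bounded (lawAt K y t) hg)
      have h2 := abs_le.1 (abs_mean_le_of_bounded (lawAt K x t) hg)
      rw [abs_le]
      constructor <;> linarith
  have e : ∀ t, mean (lawAt K x t) g
      = mean p g - mean p fun y => mean (lawAt K y t) g - mean (lawAt K x t) g := by
    intro t
    have h1 : mean p g = mean p fun y => mean (lawAt K y t) g := by
      conv_lhs => rw [← bind_lawAt hp t]
      exact mean_bind _ _ fun y _ => hg y
    have h2 : (mean p fun y => mean (lawAt K y t) g - mean (lawAt K x t) g)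
        = (mean p fun y => mean (lawAt K y t) g) - mean p fun _ => mean (lawAt K x t) g := by
      simp only [mean, mul_sub]
      refine Summable.tsum_sub ?_ ?_
      · exact summable_mean_of_bounded p fun y _ => abs_mean_le_of_bounded (lawAt K y t) hg
      · exact (summable_toReal p).mul_right _
    rw [h2, mean_const, ← h1]
    ring
  rw [funext e]
  have h := hlim.const_sub (mean p g)
  rwa [tsum_zero, sub_zero] at h

/-! ### Existence of a stationary law -/

theorem pmf_eq_of_le {p q : PMF α} (h : ∀ x, p x ≤ q x) : p = q := by
  ext x
  by_contra hne
  have h1 := ENNReal.tsum_lt_tsum p.tsum_coe_ne_top h (lt_of_le_of_ne (h x) hne)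
  rw [p.tsum_coe, q.tsum_coe] at h1
  exact lt_irrefl _ h1

/-- Telescoping of the drift condition along the chain, arranged without subtraction so that it
makes sense for infinite values. -/
theorem sum_lmean_lawAt_le {K : α → PMF α} {V f : α → ℝ≥0∞} {C : ℝ≥0∞}
    (hdrift : ∀ x, lmean (K x) V + f x ≤ V x + C) (x : α) (T : ℕ) :
    lmean (lawAt K x T) V + ∑ t ∈ Finset.range T, lmean (lawAt K x t) f ≤ V x + T * C := by
  induction T with
  | zero => simp [lawAt, lmean_pure]
  | succ T ih =>
    have h1 : lmean (lawAt K x (T + 1)) V + lmean (lawAt K x T) f ≤ lmean (lawAt K x T) V + C := by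
      rw [lawAt, lmean_bind, ← lmean_add, ← lmean_const (lawAt K x T) C, ← lmean_add]
      exact lmean_mono _ hdrift
    calc _ = (lmean (lawAt K x (T + 1)) V + lmean (lawAt K x T) f)
          + ∑ t ∈ Finset.range T, lmean (lawAt K x t) f := by
          rw [Finset.sum_range_succ]; ring
      _ ≤ (lmean (lawAt K x T) V + C) + ∑ t ∈ Finset.range T, lmean (lawAt K x t) f := by gcongr
      _ = (lmean (lawAt K x T) V + ∑ t ∈ Finset.range T, lmean (lawAt K x t) f) + C := by ring
      _ ≤ V x + T * C + C := by gcongr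
      _ = _ := by push_cast; ring

/-- The average of the laws at the times before `T`. -/
def cesaro (K : α → PMF α) (x : α) (T : ℕ) (y : α) : ℝ≥0∞ :=
  (T : ℝ≥0∞)⁻¹ * ∑ t ∈ Finset.range T, lawAt K x t y

theorem tsum_cesaro_mul (K : α → PMF α) (x : α) (T : ℕ) (f : α → ℝ≥0∞) :
    ∑' y, cesaro K x T y * f y
      = (T : ℝ≥0∞)⁻¹ * ∑ t ∈ Finset.range T, lmean (lawAt K x t) f := by
  simp only [cesaro, lmean, mul_assoc, ENNReal.tsum_mul_left, Finset.sum_mul]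
  rw [Summable.tsum_finsetSum fun _ _ => ENNReal.summable]

theorem tsum_cesaro_mul_le {K : α → PMF α} {V f : α → ℝ≥0∞} {C : ℝ≥0∞}
    (hdrift : ∀ x, lmean (K x) V + f x ≤ V x + C) (x : α) {T : ℕ} (hT : T ≠ 0) :
    ∑' y, cesaro K x T y * f y ≤ (T : ℝ≥0∞)⁻¹ * V x + C := by
  rw [tsum_cesaro_mul]
  have hT' : (T : ℝ≥0∞)⁻¹ * T = 1 :=
    ENNReal.inv_mul_cancel (by exact_mod_cast hT) (ENNReal.natCast_ne_top T)
  calc _ ≤ (T : ℝ≥0∞)⁻¹ * (V x + T * C) := by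
        gcongr
        exact le_add_self.trans (sum_lmean_lawAt_le hdrift x T)
    _ = _ := by rw [mul_add, ← mul_assoc, hT', one_mul]

/-- Krylov–Bogoliubov argument: the drift bounds the time averages of `f`, whose finite sublevel
sets give tightness. The second conclusion ranges over all drift pairs `W`, `g`, so that one law
satisfies every moment bound at once. -/
theorem exists_stationary {K : α → PMF α} {x₀ : α} {V f : α → ℝ≥0∞} {C : ℝ≥0∞} (hC : C ≠ ⊤)
    (hV : V x₀ ≠ ⊤) (hf : ∀ M : ℕ, {x | f x ≤ M}.Finite)
    (hdrift : ∀ x, lmean (K x) V + f x ≤ V x + C) :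
    ∃ p : PMF α, p.bind K = p ∧ ∀ (W g : α → ℝ≥0∞) (c : ℝ≥0∞), W x₀ ≠ ⊤ → (∀ x, g x ≠ ⊤) →
      (∀ x, lmean (K x) W + g x ≤ W x + c) → lmean p g ≤ c := by
  have hU : (hyperfilter ℕ : Filter ℕ) ≤ atTop := by
    rw [← Nat.cofinite_eq_atTop]
    exact hyperfilter_le_cofinite
  have hne : ∀ᶠ T : ℕ in (hyperfilter ℕ : Filter ℕ), T ≠ 0 := hU (eventually_ne_atTop 0)
  have hinv : Tendsto (fun T : ℕ => (T : ℝ≥0∞)⁻¹) (hyperfilter ℕ : Filter ℕ) (𝓝 0) :=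
    ENNReal.tendsto_inv_nat_nhds_zero.mono_left hU
  -- Compactness of `ℝ≥0∞` gives all pointwise limits along one ultrafilter, with no diagonal
  -- extraction.
  have hlim : ∀ y, ∃ l, Tendsto (fun T => cesaro K x₀ T y) (hyperfilter ℕ : Filter ℕ) (𝓝 l) :=
    fun y => ⟨_, ((hyperfilter ℕ).map fun T => cesaro K x₀ T y).le_nhds_lim⟩
  choose m hm using hlim
  have hmom : ∀ (W g : α → ℝ≥0∞) (c : ℝ≥0∞), W x₀ ≠ ⊤ → (∀ x, g x ≠ ⊤) →
      (∀ x, lmean (K x) W + g x ≤ W x + c) → ∑' x, m x * g x ≤ c := by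
    intro W g c hW hg hd
    rw [ENNReal.tsum_eq_iSup_sum]
    refine iSup_le fun A => ?_
    have h1 : Tendsto (fun T => ∑ y ∈ A, cesaro K x₀ T y * g y) (hyperfilter ℕ : Filter ℕ)
        (𝓝 (∑ y ∈ A, m y * g y)) :=
      tendsto_finsetSum _ fun y _ => ENNReal.Tendsto.mul_const (hm y) (Or.inr (hg y))
    have h2 : Tendsto (fun T : ℕ => (T : ℝ≥0∞)⁻¹ * W x₀ + c) (hyperfilter ℕ : Filter ℕ)
        (𝓝 (0 * W x₀ + c)) :=
      (ENNReal.Tendsto.mul_const hinv (Or.inr hW)).add_const c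
    rw [zero_mul, zero_add] at h2
    refine le_of_tendsto_of_tendsto h1 h2 (hne.mono fun T hT => ?_)
    exact (ENNReal.sum_le_tsum A).trans (tsum_cesaro_mul_le hd x₀ hT)
  have hle : ∑' y, m y ≤ 1 := by
    have h := hmom (fun _ => 0) (fun _ => 1) 1 (by simp) (by simp) (by simp [lmean])
    simpa using h
  -- Tightness by Markov's inequality: asymptotically, mass at most `C / M` lies outside the finite
  -- set where `f ≤ M`.
  have hge : ∀ M : ℕ, M ≠ 0 → 1 ≤ ∑' y, m y + C * (M : ℝ≥0∞)⁻¹ := by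
    intro M hM
    have hM0 : (M : ℝ≥0∞) ≠ 0 := by exact_mod_cast hM
    have hMt : (M : ℝ≥0∞)⁻¹ ≠ ⊤ := ENNReal.inv_ne_top.2 hM0
    have h1 : Tendsto (fun T => ∑ y ∈ (hf M).toFinset, cesaro K x₀ T y
        + ((T : ℝ≥0∞)⁻¹ * V x₀ + C) * (M : ℝ≥0∞)⁻¹) (hyperfilter ℕ : Filter ℕ)
        (𝓝 (∑ y ∈ (hf M).toFinset, m y + (0 * V x₀ + C) * (M : ℝ≥0∞)⁻¹)) := by
      refine Tendsto.add (tendsto_finsetSum _ fun y _ => hm y) ?_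
      refine ENNReal.Tendsto.mul_const ?_ (Or.inr hMt)
      exact (ENNReal.Tendsto.mul_const hinv (Or.inr hV)).add_const C
    rw [zero_mul, zero_add] at h1
    refine (ge_of_tendsto h1 (hne.mono fun T hT => ?_)).trans
      (add_le_add_left (ENNReal.sum_le_tsum _) _)
    have hT' : (T : ℝ≥0∞)⁻¹ * T = 1 :=
      ENNReal.inv_mul_cancel (by exact_mod_cast hT) (ENNReal.natCast_ne_top T)
    have h2 : ∑' y, cesaro K x₀ T y = 1 := by
      have h := tsum_cesaro_mul K x₀ T fun _ => 1
      simp only [mul_one, lmean_const, Finset.sum_const, Finset.card_range, nsmul_eq_mul] at h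
      rw [h, hT']
    calc (1 : ℝ≥0∞) = ∑' y, cesaro K x₀ T y := h2.symm
      _ ≤ ∑' y, (({y | f y ≤ M} : Set α).indicator (cesaro K x₀ T) y
            + cesaro K x₀ T y * f y * (M : ℝ≥0∞)⁻¹) := by
          refine ENNReal.tsum_le_tsum fun y => ?_
          by_cases hy : f y ≤ M
          · rw [Set.indicator_of_mem (by exact hy)]
            exact le_self_add
          · refine le_trans ?_ le_add_self
            rw [mul_assoc]
            refine le_mul_of_one_le_right' ?_
            rw [← ENNReal.mul_inv_cancel hM0 (ENNReal.natCast_ne_top M)]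
            gcongr
            exact (not_le.1 hy).le
      _ = ∑ y ∈ (hf M).toFinset, cesaro K x₀ T y
            + (∑' y, cesaro K x₀ T y * f y) * (M : ℝ≥0∞)⁻¹ := by
          rw [ENNReal.tsum_add, ENNReal.tsum_mul_right]
          congr 1
          rw [sum_eq_tsum_indicator]
          simp
      _ ≤ _ := by
          gcongr
          exact tsum_cesaro_mul_le hdrift x₀ hT
  have hone : ∑' y, m y = 1 := by
    refine le_antisymm hle ?_
    have h1 : Tendsto (fun M : ℕ => ∑' y, m y + C * (M : ℝ≥0∞)⁻¹) atTop
        (𝓝 (∑' y, m y + C * 0)) :=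
      (ENNReal.Tendsto.const_mul ENNReal.tendsto_inv_nat_nhds_zero (Or.inr hC)).const_add _
    rw [mul_zero, add_zero] at h1
    exact ge_of_tendsto h1 ((eventually_ne_atTop 0).mono hge)
  let p : PMF α := ⟨m, hone ▸ ENNReal.summable.hasSum⟩
  -- Passing to the limit in finite partial sums yields only `p.bind K ≤ p`; equality follows
  -- because both have total mass 1.
  refine ⟨p, pmf_eq_of_le fun y => ?_, hmom⟩
  rw [PMF.bind_apply, ENNReal.tsum_eq_iSup_sum]
  refine iSup_le fun A => ?_
  have h1 : Tendsto (fun T => ∑ x ∈ A, cesaro K x₀ T x * K x y) (hyperfilter ℕ : Filter ℕ)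
      (𝓝 (∑ x ∈ A, m x * K x y)) :=
    tendsto_finsetSum _ fun x _ => ENNReal.Tendsto.mul_const (hm x) (Or.inr ((K x).apply_ne_top y))
  have h2 : Tendsto (fun T : ℕ => cesaro K x₀ T y + (T : ℝ≥0∞)⁻¹) (hyperfilter ℕ : Filter ℕ)
      (𝓝 (m y + 0)) := (hm y).add hinv
  rw [add_zero] at h2
  refine le_of_tendsto_of_tendsto' h1 h2 fun T => (ENNReal.sum_le_tsum A).trans ?_
  rw [tsum_cesaro_mul]
  have h3 : ∀ t, lmean (lawAt K x₀ t) (fun x => K x y) = lawAt K x₀ (t + 1) y := fun t => rfl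
  simp only [h3, cesaro]
  calc (T : ℝ≥0∞)⁻¹ * ∑ t ∈ Finset.range T, lawAt K x₀ (t + 1) y
      ≤ (T : ℝ≥0∞)⁻¹ * (∑ t ∈ Finset.range T, lawAt K x₀ t y + 1) := by
        gcongr
        calc ∑ t ∈ Finset.range T, lawAt K x₀ (t + 1) y
            ≤ ∑ t ∈ Finset.range (T + 1), lawAt K x₀ t y := by
              rw [Finset.sum_range_succ']
              exact le_self_add
          _ ≤ _ := by
              rw [Finset.sum_range_succ]
              gcongr
              exact PMF.coe_le_one _ _
    _ = _ := by rw [mul_add, mul_one]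

/-! ### Moment bounds from a drift condition -/

theorem lmean_drift_of_mean {K : α → PMF α} (hK : ∀ x, (K x).support.Finite) {V f : α → ℝ} {C : ℝ}
    (hV0 : ∀ x, 0 ≤ V x) (hf0 : ∀ x, 0 ≤ f x) (hC : 0 ≤ C)
    (hdrift : ∀ x, mean (K x) V + f x ≤ V x + C) (x : α) :
    lmean (K x) (fun y => ENNReal.ofReal (V y)) + ENNReal.ofReal (f x)
      ≤ ENNReal.ofReal (V x) + ENNReal.ofReal C := by
  rw [← ofReal_mean _ hV0 (summable_mean_of_finite (hK x) V),
    ← ENNReal.ofReal_add (mean_nonneg _ fun y _ => hV0 y) (hf0 x),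
    ← ENNReal.ofReal_add (hV0 x) hC]
  exact ENNReal.ofReal_le_ofReal (hdrift x)

/-- A function with drift `≤ -δ √W + C` and increments of square at most `c W + c`. -/
structure RootDrift (K : α → PMF α) (W : α → ℝ) (δ C c : ℝ) : Prop where
  nonneg : ∀ x, 0 ≤ W x
  drift : ∀ x, mean (K x) W ≤ W x - δ * √(W x) + C
  increment : ∀ x, ∀ y ∈ (K x).support, (W y - W x) ^ 2 ≤ c * W x + c

/-- The bound for the stationary mean of `W` that follows from `RootDrift`. -/
def driftBound (δ C c : ℝ) : ℝ := (2 * C + c + 1) ^ 3 / δ ^ 2 + c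

/-- Expanding the square gives a drift of at most `-2 δ W^(3/2) + (2 C + c) W + c`, and the leading
term absorbs the linear one with `W` to spare. The resulting drift condition for `W²` bounds the
stationary mean of `W`. -/
theorem RootDrift.sq_drift {K : α → PMF α} (hK : ∀ x, (K x).support.Finite) {W : α → ℝ}
    {δ C c : ℝ} (h : RootDrift K W δ C c) (hδ : 0 < δ) (hC : 0 ≤ C) (hc : 0 ≤ c) (x : α) :
    mean (K x) (fun y => W y ^ 2) + W x ≤ W x ^ 2 + driftBound δ C c := by
  have e : mean (K x) (fun y => W y ^ 2)
      = -(W x) ^ 2 + 2 * W x * mean (K x) W + mean (K x) fun y => (W y - W x) ^ 2 := by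
    rw [← mean_mul_left, ← mean_const (K x) (-(W x) ^ 2), ← mean_add (hK x), ← mean_add (hK x)]
    congr 1
    funext y
    ring
  have h1 : (mean (K x) fun y => (W y - W x) ^ 2) ≤ c * W x + c := by
    rw [← mean_const (K x) (c * W x + c)]
    exact mean_mono (hK x) (h.increment x)
  have h2 := mul_le_mul_of_nonneg_left (h.drift x) (h.nonneg x)
  obtain ⟨r, hr⟩ : ∃ r, r = √(W x) := ⟨_, rfl⟩
  have hr0 : 0 ≤ r := hr ▸ Real.sqrt_nonneg _
  have hrW : W x = r ^ 2 := by rw [hr, Real.sq_sqrt (h.nonneg x)]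
  rw [← hr] at h2
  set B := 2 * C + c + 1 with hB
  have hB0 : 0 ≤ B := by positivity
  -- For `r ≥ B / δ` the cubic term dominates; otherwise the left side is at most its value at `B /
  -- δ`, which is the constant.
  have h3 : B * r ^ 2 ≤ δ * r ^ 3 + B ^ 3 / δ ^ 2 := by
    rcases le_total (B / δ) r with hle | hle
    · rw [div_le_iff₀ hδ] at hle
      have : 0 ≤ B ^ 3 / δ ^ 2 := by positivity
      nlinarith [mul_le_mul_of_nonneg_right hle (sq_nonneg r)]
    · have h4 : B * r ^ 2 ≤ B * (B / δ) ^ 2 := by gcongr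
      have h5 : B * (B / δ) ^ 2 = B ^ 3 / δ ^ 2 := by field_simp
      have h6 : 0 ≤ δ * r ^ 3 := by positivity
      linarith
  have h7 : 0 ≤ δ * r ^ 3 := by positivity
  rw [driftBound, ← hB, e]
  rw [hrW] at h2 h1 ⊢
  nlinarith

theorem driftBound_nonneg {δ C c : ℝ} (hC : 0 ≤ C) (hc : 0 ≤ c) : 0 ≤ driftBound δ C c := by
  unfold driftBound
  positivity

/-! ### Steady state of a queue length chain -/

theorem integral_toMeasure {n : ℕ} (p : PMF (QueueState n)) {f : QueueState n → ℝ}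
    (hf : Integrable f p.toMeasure) : ∫ q, f q ∂p.toMeasure = mean p f := by
  rw [PMF.integral_eq_tsum p f hf]
  rfl

theorem lintegral_toMeasure {n : ℕ} (p : PMF (QueueState n)) (f : QueueState n → ℝ≥0∞) :
    ∫⁻ q, f q ∂p.toMeasure = lmean p f := by
  rw [lintegral_countable' f]
  refine tsum_congr fun q => ?_
  rw [PMF.toMeasure_apply_singleton _ _ (measurableSet_singleton q), mul_comm]

theorem IsSteadyState.unique {n : ℕ} {K : QueueState n → PMF (QueueState n)}
    {p p' : PMF (QueueState n)} (h : IsSteadyState K p) (h' : IsSteadyState K p') : p = p' := by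
  have h1 := tendsto_nhds_unique (h.tendsto 0) (h'.tendsto 0)
  exact PMF.toMeasure_injective (congrArg Subtype.val h1)

/-- A chain with an accessible state, driven by a function with negative drift and finite sublevel
sets, has a steady state. -/
theorem exists_steadyState {n : ℕ} {K : QueueState n → PMF (QueueState n)}
    (hK : ∀ x, (K x).support.Finite) {W : QueueState n → ℝ} {δ C c : ℝ} (hδ : 0 < δ) (hC : 0 ≤ C)
    (hc : 0 ≤ c) (hW : RootDrift K W δ C c) (hfin : ∀ M : ℝ, {x | W x ≤ M}.Finite)
    {x₀ : QueueState n} {h : QueueState n → ℕ} (hstay : x₀ ∈ (K x₀).support)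
    (hpath : ∀ x, x ≠ x₀ → ∃ y ∈ (K x).support, h y < h x) :
    ∃ p, IsSteadyState K p ∧ ∀ (W' : QueueState n → ℝ) (δ' C' c' : ℝ), 0 < δ' → 0 ≤ C' → 0 ≤ c' →
      RootDrift K W' δ' C' c' →
      lmean p (fun q => ENNReal.ofReal (W' q)) ≤ ENNReal.ofReal (driftBound δ' C' c') := by
  have hsq := hW.sq_drift hK hδ hC hc
  have hfin2 : ∀ M : ℝ, {x | W x ^ 2 ≤ M}.Finite := fun M =>
    (hfin (√M)).subset fun x hx => Real.le_sqrt_of_sq_le hx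
  have hfin3 : ∀ M : ℕ, {x | ENNReal.ofReal (W x) ≤ M}.Finite := fun M =>
    (hfin M).subset fun x hx => by
      have h1 : ENNReal.ofReal (W x) ≤ ENNReal.ofReal M := by
        rw [ENNReal.ofReal_natCast]; exact hx
      exact (ENNReal.ofReal_le_ofReal_iff (Nat.cast_nonneg M)).1 h1
  obtain ⟨p, hp, hmom⟩ := exists_stationary (K := K) (x₀ := x₀) ENNReal.ofReal_ne_top
    ENNReal.ofReal_ne_top hfin3 (lmean_drift_of_mean hK (fun x => sq_nonneg (W x)) hW.nonneg
      (driftBound_nonneg hC hc) hsq)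
  refine ⟨p, ⟨hp, fun q => ?_⟩, fun W' δ' C' c' hδ' hC' hc' hW' => ?_⟩
  · rw [ProbabilityMeasure.tendsto_iff_forall_integral_tendsto]
    intro f
    have e : ∀ p : PMF (QueueState n), ∫ q, f q ∂(toProb p : Measure (QueueState n))
        = mean p f := fun p => integral_toMeasure p (f.integrable p.toMeasure)
    simp only [e]
    exact tendsto_mean_lawAt hK (fun x => sq_nonneg (W x)) hW.nonneg hfin2 hfin hsq hstay hpath hp
      (B := ‖f‖) (fun x => f.norm_coe_le_norm x) q
  · exact hmom _ _ _ ENNReal.ofReal_ne_top (fun _ => ENNReal.ofReal_ne_top)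
      (lmean_drift_of_mean hK (fun x => sq_nonneg (W' x)) hW'.nonneg
      (driftBound_nonneg hC' hc') (hW'.sq_drift hK hδ' hC' hc'))

/-- In steady state the mean of a nonnegative integrable function does not change in one step. -/
theorem mean_step_of_stationary {K : α → PMF α} (hK : ∀ x, (K x).support.Finite) {p : PMF α}
    (hp : p.bind K = p) {f : α → ℝ} (hf0 : ∀ x, 0 ≤ f x)
    (hf : lmean p (fun x => ENNReal.ofReal (f x)) ≠ ⊤) :
    (Summable fun x => (p x).toReal * f x) ∧
    (Summable fun x => (p x).toReal * mean (K x) f) ∧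
      mean p (fun x => mean (K x) f) = mean p f := by
  have hs : ∀ g : α → ℝ, (∀ x, 0 ≤ g x) → lmean p (fun x => ENNReal.ofReal (g x)) ≠ ⊤ →
      (Summable fun x => (p x).toReal * g x) := by
    intro g hg0 hg
    refine (ENNReal.summable_toReal hg).congr fun x => ?_
    rw [ENNReal.toReal_mul, ENNReal.toReal_ofReal (hg0 x)]
  have e : lmean p (fun x => ENNReal.ofReal (mean (K x) f))
      = lmean p fun x => ENNReal.ofReal (f x) := by
    conv_rhs => rw [← hp, lmean_bind]
    congr 1
    funext x
    exact ofReal_mean _ hf0 (summable_mean_of_finite (hK x) f)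
  have h0 : ∀ x, 0 ≤ mean (K x) f := fun x => mean_nonneg _ fun y _ => hf0 y
  have h1 := hs f hf0 hf
  have h2 := hs _ h0 (e ▸ hf)
  refine ⟨h1, h2, ?_⟩
  rw [← ofReal_mean _ hf0 h1, ← ofReal_mean _ h0 h2] at e
  exact (ENNReal.ofReal_eq_ofReal_iff (tsum_nonneg fun x => mul_nonneg ENNReal.toReal_nonneg (h0 x))
    (tsum_nonneg fun x => mul_nonneg ENNReal.toReal_nonneg (hf0 x))).1 e

/-! ### Weights of permutations -/

section Perm

variable {ι : Type*} [Fintype ι]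

/-- The cyclic shifts of `ℤ/n`, the shift by 0 being the identity. -/
theorem exists_latin_square [Nonempty ι] :
    ∃ (σ : ι → Equiv.Perm ι) (k₀ : ι), σ k₀ = 1 ∧ ∀ i, Function.Bijective fun k => σ k i := by
  have : NeZero (Fintype.card ι) := ⟨Fintype.card_ne_zero⟩
  let e := Fintype.equivFin ι
  refine ⟨fun k => (e.trans (Equiv.addRight (e k))).trans e.symm, e.symm 0, ?_, fun i => ?_⟩
  · ext i
    simp
  · exact ((e.trans (Equiv.addLeft (e i))).trans e.symm).bijective

variable [DecidableEq ι]

/-- A Latin square composed with `π` splits the matrix into the weights of `n` permutations, one of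
them `π` and each of the others at most `M`. Hence no permutation has weight below the entry sum
minus `(n - 1) M`. -/
theorem sum_add_le_card_mul [Nonempty ι] {x : ι → ι → ℝ} {M : ℝ}
    (hM : ∀ σ : Equiv.Perm ι, ∑ i, x i (σ i) ≤ M) (π : Equiv.Perm ι) :
    ∑ i, ∑ j, x i j + M ≤ Fintype.card ι * M + ∑ i, x i (π i) := by
  obtain ⟨σ, k₀, hk₀, hσ⟩ := exists_latin_square (ι := ι)
  have h1 : ∑ i, ∑ j, x i j = ∑ k, ∑ i, x i ((π.trans (σ k)) i) := by
    conv_rhs => rw [Finset.sum_comm]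
    refine Finset.sum_congr rfl fun i _ => ?_
    exact ((Equiv.ofBijective _ (hσ (π i))).sum_comp fun j => x i j).symm
  have h2 : ∑ k ∈ Finset.univ.erase k₀, ∑ i, x i ((π.trans (σ k)) i)
      ≤ ∑ _k ∈ Finset.univ.erase k₀, M := Finset.sum_le_sum fun k _ => hM _
  rw [h1, ← Finset.add_sum_erase _ _ (Finset.mem_univ k₀), hk₀]
  have h3 : ∑ _k ∈ Finset.univ.erase k₀, M + M = Fintype.card ι * M := by
    rw [Finset.sum_erase_add _ _ (Finset.mem_univ k₀)]
    simp
  have h4 : ∑ i, x i ((π.trans (1 : Equiv.Perm ι)) i) = ∑ i, x i (π i) := rfl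
  linarith

theorem sum_le_card_mul {x : ι → ι → ℝ} {M : ℝ}
    (hM : ∀ σ : Equiv.Perm ι, ∑ i, x i (σ i) ≤ M) :
    ∑ i, ∑ j, x i j ≤ Fintype.card ι * M := by
  rcases isEmpty_or_nonempty ι with h | h
  · simp
  · have h1 := sum_add_le_card_mul hM 1
    have h2 := hM 1
    linarith

/-- The cross difference is the difference of the weights of two permutations that differ by a
transposition, and both weights lie in an interval of the stated length by `sum_add_le_card_mul`. -/
theorem abs_cross_le {x : ι → ι → ℝ} {M : ℝ}
    (hM : ∀ σ : Equiv.Perm ι, ∑ i, x i (σ i) ≤ M) (i j k l : ι) :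
    |x i j + x k l - x i l - x k j| ≤ Fintype.card ι * M - ∑ i, ∑ j, x i j := by
  have : Nonempty ι := ⟨i⟩
  have h0 := sum_le_card_mul hM
  by_cases hik : i = k
  · subst hik
    rw [show x i j + x i l - x i l - x i j = 0 by ring, abs_zero]
    linarith
  by_cases hjl : j = l
  · subst hjl
    rw [show x i j + x k j - x i j - x k j = 0 by ring, abs_zero]
    linarith
  obtain ⟨π, hi, hk⟩ : ∃ π : Equiv.Perm ι, π i = j ∧ π k = l := by
    refine ⟨(Equiv.swap i j).trans (Equiv.swap (Equiv.swap i j k) l), ?_, ?_⟩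
    · have h1 : j ≠ Equiv.swap i j k := fun h => by
        have h2 : Equiv.swap i j i = Equiv.swap i j k := by rw [Equiv.swap_apply_left]; exact h
        exact hik ((Equiv.swap i j).injective h2)
      rw [Equiv.trans_apply, Equiv.swap_apply_left, Equiv.swap_apply_of_ne_of_ne h1 hjl]
    · rw [Equiv.trans_apply, Equiv.swap_apply_left]
  have e : ∑ m, x m (π m) - ∑ m, x m (((Equiv.swap i k).trans π) m)
      = x i j + x k l - x i l - x k j := by
    rw [← Finset.sum_sub_distrib, Fintype.sum_eq_add i k hik]
    · simp only [Equiv.trans_apply, Equiv.swap_apply_left, Equiv.swap_apply_right, hi, hk]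
      ring
    · rintro m ⟨h1, h2⟩
      rw [Equiv.trans_apply, Equiv.swap_apply_of_ne_of_ne h1 h2, sub_self]
  have h1 := sum_add_le_card_mul hM π
  have h2 := sum_add_le_card_mul hM ((Equiv.swap i k).trans π)
  have h3 := hM π
  have h4 := hM ((Equiv.swap i k).trans π)
  rw [← e, abs_le]
  constructor <;> linarith

/-- The served packets of a diagonal schedule of maximum weight `x` have a nonnegative component
orthogonal to the row and column indicators. -/
theorem served_diag_nonneg {x : ι → ι → ℝ} (hx : ∀ i j, 0 ≤ x i j)
    (hM : ∀ σ : Equiv.Perm ι, ∑ i, x i (σ i) ≤ ∑ i, x i i) (J : Finset ι)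
    (hJ : ∀ i, i ∈ J ↔ x i i ≠ 0) :
    (Fintype.card ι : ℝ) * (∑ i ∈ J, ∑ j, x i j + ∑ j ∈ J, ∑ i, x i j)
      ≤ (Fintype.card ι : ℝ) ^ 2 * ∑ i ∈ J, x i i + J.card * ∑ i, ∑ j, x i j := by
  have hJ0 : ∀ i ∉ J, x i i = 0 := fun i hi => by
    by_contra h
    exact hi ((hJ i).2 h)
  have hdiag : ∑ i, x i i = ∑ i ∈ J, x i i :=
    (Finset.sum_subset (Finset.subset_univ J) fun i _ hi => hJ0 i hi).symm
  -- Otherwise swapping `i` and `j` would increase the diagonal weight.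
  have hzero : ∀ i ∉ J, ∀ j ∉ J, x i j = 0 := by
    intro i hi j hj
    by_cases hij : i = j
    · rw [← hij]; exact hJ0 i hi
    have h1 := hM (Equiv.swap i j)
    have e : ∑ m, x m (Equiv.swap i j m) - ∑ m, x m m = x i j + x j i := by
      rw [← Finset.sum_sub_distrib, Fintype.sum_eq_add i j hij]
      · rw [Equiv.swap_apply_left, Equiv.swap_apply_right, hJ0 i hi, hJ0 j hj]
        ring
      · rintro m ⟨h1, h2⟩
        rw [Equiv.swap_apply_of_ne_of_ne h1 h2, sub_self]
    have h2 := hx i j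
    have h3 := hx j i
    linarith
  -- A permutation of `J` extends by the identity, so the block satisfies the same weight bound.
  have hblock : ∑ i ∈ J, ∑ j ∈ J, x i j ≤ J.card * ∑ i, x i i := by
    have h1 : ∀ σ : Equiv.Perm {i // i ∈ J}, ∑ i : {i // i ∈ J}, x i (σ i) ≤ ∑ i, x i i := by
      intro σ
      refine le_trans ?_ (hM (Equiv.Perm.ofSubtype σ))
      calc ∑ i : {i // i ∈ J}, x i (σ i)
          = ∑ i : {i // i ∈ J}, x i (Equiv.Perm.ofSubtype σ i) :=
            Finset.sum_congr rfl fun i _ => by rw [Equiv.Perm.ofSubtype_apply_coe]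
        _ = ∑ i ∈ J, x i (Equiv.Perm.ofSubtype σ i) :=
            Finset.sum_coe_sort J fun i => x i (Equiv.Perm.ofSubtype σ i)
        _ ≤ _ := Finset.sum_le_sum_of_subset_of_nonneg (Finset.subset_univ J)
            fun i _ _ => hx _ _
    have h2 := sum_le_card_mul (x := fun i j : {i // i ∈ J} => x i j) h1
    rw [Fintype.card_coe] at h2
    refine le_trans (le_of_eq ?_) h2
    rw [← Finset.sum_coe_sort J]
    exact Finset.sum_congr rfl fun i _ => (Finset.sum_coe_sort J fun j => x i j).symm
  have hcross : ∑ i ∈ J, ∑ j, x i j + ∑ j ∈ J, ∑ i, x i j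
      = ∑ i, ∑ j, x i j + ∑ i ∈ J, ∑ j ∈ J, x i j := by
    have h1 : ∑ i, ∑ j, x i j = ∑ i ∈ J, ∑ j, x i j + ∑ i ∈ Jᶜ, ∑ j ∈ J, x i j := by
      rw [← Finset.sum_add_sum_compl J]
      congr 1
      refine Finset.sum_congr rfl fun i hi => ?_
      refine (Finset.sum_subset (Finset.subset_univ J) fun j _ hj => ?_).symm
      exact hzero i (Finset.mem_compl.1 hi) j hj
    have h2 : ∑ j ∈ J, ∑ i, x i j = ∑ i ∈ J, ∑ j ∈ J, x i j + ∑ i ∈ Jᶜ, ∑ j ∈ J, x i j := by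
      rw [Finset.sum_comm, Finset.sum_add_sum_compl J]
    rw [h1, h2]
    ring
  have htot := sum_le_card_mul hM
  have hcard : (J.card : ℝ) ≤ Fintype.card ι := by exact_mod_cast J.card_le_univ
  have hn : (0 : ℝ) ≤ Fintype.card ι := Nat.cast_nonneg _
  rw [hcross, ← hdiag]
  -- With `M` the diagonal weight and `T` the entry sum, what remains after `hblock` is `(n - |J|)
  -- (n M - T) ≥ 0`.
  nlinarith [mul_nonneg (sub_nonneg.2 hcard) (sub_nonneg.2 htot),
    mul_nonneg hn (sub_nonneg.2 hblock)]

end Perm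

/-! ### Row sums, column sums and the orthogonal component -/

section Projection

variable {n : ℕ}

/-- The sum of row `i`. -/
def rowSum (x : Fin n → Fin n → ℝ) (i : Fin n) : ℝ := ∑ j, x i j

/-- The sum of column `j`. -/
def colSum (x : Fin n → Fin n → ℝ) (j : Fin n) : ℝ := ∑ i, x i j

/-- The sum of all entries. -/
def entrySum (x : Fin n → Fin n → ℝ) : ℝ := ∑ i, ∑ j, x i j

/-- The sum of the squares of the entries. -/
def sqSum (x : Fin n → Fin n → ℝ) : ℝ := ∑ i, ∑ j, x i j ^ 2

/-- The component of `x` orthogonal to the row and column indicators. -/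
def perp (x : Fin n → Fin n → ℝ) (i j : Fin n) : ℝ :=
  x i j - rowSum x i / n - colSum x j / n + entrySum x / n ^ 2

/-- The quadratic form of the row and column sums. -/
def marginForm (x : Fin n → Fin n → ℝ) : ℝ :=
  ∑ i, rowSum x i ^ 2 + ∑ j, colSum x j ^ 2 - entrySum x ^ 2 / n

theorem sum_rowSum (x : Fin n → Fin n → ℝ) : ∑ i, rowSum x i = entrySum x := rfl

theorem sum_colSum (x : Fin n → Fin n → ℝ) : ∑ j, colSum x j = entrySum x := Finset.sum_comm

theorem sqSum_nonneg (x : Fin n → Fin n → ℝ) : 0 ≤ sqSum x :=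
  Finset.sum_nonneg fun _ _ => Finset.sum_nonneg fun _ _ => sq_nonneg _

theorem rowSum_add (x y : Fin n → Fin n → ℝ) (i : Fin n) :
    rowSum (x + y) i = rowSum x i + rowSum y i := Finset.sum_add_distrib

theorem colSum_add (x y : Fin n → Fin n → ℝ) (i : Fin n) :
    colSum (x + y) i = colSum x i + colSum y i := Finset.sum_add_distrib

theorem entrySum_add (x y : Fin n → Fin n → ℝ) :
    entrySum (x + y) = entrySum x + entrySum y := by
  simp only [← sum_rowSum, rowSum_add, Finset.sum_add_distrib]

theorem perp_add (x y : Fin n → Fin n → ℝ) : perp (x + y) = perp x + perp y := by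
  funext i j
  simp only [perp, rowSum_add, colSum_add, entrySum_add, Pi.add_apply]
  ring

theorem rowSum_perp (x : Fin n → Fin n → ℝ) (i : Fin n) : rowSum (perp x) i = 0 := by
  have hn : (n : ℝ) ≠ 0 := by exact_mod_cast i.pos.ne'
  simp only [rowSum, perp, Finset.sum_add_distrib, Finset.sum_sub_distrib, ← Finset.sum_div,
    sum_colSum]
  simp only [Finset.sum_const, Finset.card_univ, Fintype.card_fin, nsmul_eq_mul]
  field_simp
  ring

theorem colSum_perp (x : Fin n → Fin n → ℝ) (j : Fin n) : colSum (perp x) j = 0 := by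
  have hn : (n : ℝ) ≠ 0 := by exact_mod_cast j.pos.ne'
  simp only [colSum, perp, Finset.sum_add_distrib, Finset.sum_sub_distrib, ← Finset.sum_div,
    sum_rowSum]
  simp only [Finset.sum_const, Finset.card_univ, Fintype.card_fin, nsmul_eq_mul]
  field_simp
  ring

theorem entrySum_perp (x : Fin n → Fin n → ℝ) : entrySum (perp x) = 0 := by
  simp only [← sum_rowSum, rowSum_perp, Finset.sum_const_zero]

/-- The inner product with a matrix in terms of the margins. -/
theorem sum_mul_perp (y x : Fin n → Fin n → ℝ) :
    ∑ i, ∑ j, y i j * perp x i j = ∑ i, ∑ j, y i j * x i j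
      - (∑ i, rowSum y i * rowSum x i) / n - (∑ j, colSum y j * colSum x j) / n
      + entrySum y * entrySum x / n ^ 2 := by
  have h1 : ∑ i, ∑ j, y i j * (rowSum x i / n) = (∑ i, rowSum y i * rowSum x i) / n := by
    simp only [← Finset.sum_mul, Finset.sum_div, rowSum, mul_div_assoc]
  have h2 : ∑ i, ∑ j, y i j * (colSum x j / n) = (∑ j, colSum y j * colSum x j) / n := by
    rw [Finset.sum_comm]
    simp only [← Finset.sum_mul, Finset.sum_div, colSum, mul_div_assoc]
  have h3 : ∑ i, ∑ j, y i j * (entrySum x / n ^ 2) = entrySum y * entrySum x / n ^ 2 := by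
    simp only [← Finset.sum_mul, mul_div_assoc]
    rfl
  rw [← h1, ← h2, ← h3]
  simp only [perp, mul_add, mul_sub, Finset.sum_add_distrib, Finset.sum_sub_distrib]

/-- `perp` is the orthogonal projection onto the matrices with zero margins. -/
theorem sum_perp_mul_perp (x y : Fin n → Fin n → ℝ) :
    ∑ i, ∑ j, perp x i j * perp y i j = ∑ i, ∑ j, perp x i j * y i j := by
  rw [sum_mul_perp]
  simp [rowSum_perp, colSum_perp, entrySum_perp]

theorem sqSum_add (x y : Fin n → Fin n → ℝ) :
    sqSum (x + y) = sqSum x + 2 * ∑ i, ∑ j, x i j * y i j + sqSum y := by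
  simp only [sqSum, Finset.mul_sum, ← Finset.sum_add_distrib, Pi.add_apply]
  exact Finset.sum_congr rfl fun i _ => Finset.sum_congr rfl fun j _ => by ring

theorem sqSum_perp_add (x y : Fin n → Fin n → ℝ) :
    sqSum (perp (x + y)) = sqSum (perp x) + 2 * ∑ i, ∑ j, perp x i j * y i j
      + sqSum (perp y) := by
  rw [perp_add, sqSum_add, sum_perp_mul_perp]

theorem sqSum_perp (x : Fin n → Fin n → ℝ) :
    sqSum (perp x) = ∑ i, ∑ j, x i j * perp x i j := by
  have h := sum_perp_mul_perp x x
  simp only [sqSum, sq]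
  rw [h]
  simp only [mul_comm]

theorem sqSum_perp_le (x : Fin n → Fin n → ℝ) : sqSum (perp x) ≤ sqSum x := by
  have h : 0 ≤ ∑ i, ∑ j, (x i j - perp x i j) ^ 2 :=
    Finset.sum_nonneg fun _ _ => Finset.sum_nonneg fun _ _ => sq_nonneg _
  have e : ∑ i, ∑ j, (x i j - perp x i j) ^ 2
      = sqSum x - 2 * ∑ i, ∑ j, x i j * perp x i j + sqSum (perp x) := by
    simp only [sqSum, Finset.mul_sum, ← Finset.sum_add_distrib, ← Finset.sum_sub_distrib]
    exact Finset.sum_congr rfl fun i _ => Finset.sum_congr rfl fun j _ => by ring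
  rw [e, ← sqSum_perp] at h
  linarith

theorem marginForm_eq (hn : n ≠ 0) (x : Fin n → Fin n → ℝ) :
    marginForm x = n * (sqSum x - sqSum (perp x)) := by
  have hn' : (n : ℝ) ≠ 0 := by exact_mod_cast hn
  have e : ∑ i, ∑ j, x i j * x i j = sqSum x := by simp only [sqSum, sq]
  rw [sqSum_perp, sum_mul_perp, e, marginForm]
  simp only [← sq]
  field_simp
  ring

theorem marginForm_nonneg (hn : n ≠ 0) (x : Fin n → Fin n → ℝ) : 0 ≤ marginForm x := by
  rw [marginForm_eq hn]
  exact mul_nonneg (Nat.cast_nonneg n) (sub_nonneg.2 (sqSum_perp_le x))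

theorem marginForm_le (hn : n ≠ 0) (x : Fin n → Fin n → ℝ) : marginForm x ≤ n * sqSum x := by
  rw [marginForm_eq hn]
  exact mul_le_mul_of_nonneg_left (sub_le_self _ (sqSum_nonneg _)) (Nat.cast_nonneg n)

/-- The inner product of the margins, the polar form of `marginForm`. -/
def marginInner (x y : Fin n → Fin n → ℝ) : ℝ :=
  ∑ i, rowSum x i * rowSum y i + ∑ j, colSum x j * colSum y j - entrySum x * entrySum y / n

theorem marginForm_add (x y : Fin n → Fin n → ℝ) :
    marginForm (x + y) = marginForm x + 2 * marginInner x y + marginForm y := by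
  simp only [marginForm, marginInner, rowSum_add, colSum_add, entrySum_add, add_sq,
    Finset.sum_add_distrib, mul_assoc, ← Finset.mul_sum]
  ring

/-- The margin inner product with a matrix of disjoint support. -/
theorem marginInner_of_disjoint (hn : n ≠ 0) {x u : Fin n → Fin n → ℝ}
    (h : ∀ i j, u i j * x i j = 0) :
    marginInner x u = -(n * ∑ i, ∑ j, u i j * perp x i j) := by
  have hn' : (n : ℝ) ≠ 0 := by exact_mod_cast hn
  rw [sum_mul_perp, marginInner]
  simp only [h, Finset.sum_const_zero, mul_comm (rowSum x _), mul_comm (colSum x _)]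
  field_simp
  ring

/-- The entry `perp x i j` is the average over `k`, `l` of the cross differences bounded in
`abs_cross_le`. -/
theorem abs_perp_le {x : Fin n → Fin n → ℝ} {M : ℝ}
    (hM : ∀ σ : Equiv.Perm (Fin n), ∑ i, x i (σ i) ≤ M) (i j : Fin n) :
    |perp x i j| ≤ n * M - entrySum x := by
  have hn : (n : ℝ) ≠ 0 := by exact_mod_cast i.pos.ne'
  have e : (n : ℝ) ^ 2 * perp x i j = ∑ k, ∑ l, (x i j + x k l - x i l - x k j) := by
    simp only [Finset.sum_sub_distrib, Finset.sum_add_distrib, Finset.sum_const, Finset.card_univ,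
      Fintype.card_fin, nsmul_eq_mul, ← Finset.mul_sum]
    rw [perp]
    simp only [rowSum, colSum, entrySum]
    field_simp
    ring
  have h : |(n : ℝ) ^ 2 * perp x i j| ≤ (n : ℝ) ^ 2 * (n * M - entrySum x) := by
    rw [e]
    refine (Finset.abs_sum_le_sum_abs _ _).trans ?_
    refine (Finset.sum_le_sum fun k _ => (Finset.abs_sum_le_sum_abs _ _).trans
      (Finset.sum_le_sum fun l _ => abs_cross_le hM i j k l)).trans (le_of_eq ?_)
    simp only [Finset.sum_const, Finset.card_univ, Fintype.card_fin, nsmul_eq_mul, entrySum]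
    ring
  rw [abs_mul, abs_of_nonneg (by positivity)] at h
  exact le_of_mul_le_mul_left h (by positivity)

theorem sqrt_sqSum_perp_le (hn : n ≠ 0) {x : Fin n → Fin n → ℝ} {M : ℝ}
    (hM : ∀ σ : Equiv.Perm (Fin n), ∑ i, x i (σ i) ≤ M) :
    √(sqSum (perp x)) ≤ n * (n * M - entrySum x) := by
  have h0 : 0 ≤ n * M - entrySum x :=
    (abs_nonneg _).trans (abs_perp_le hM ⟨0, hn.bot_lt⟩ ⟨0, hn.bot_lt⟩)
  refine Real.sqrt_le_iff.2 ⟨by positivity, ?_⟩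
  have h : sqSum (perp x) ≤ ∑ _i : Fin n, ∑ _j : Fin n, (n * M - entrySum x) ^ 2 :=
    Finset.sum_le_sum fun i _ => Finset.sum_le_sum fun j _ =>
      sq_le_sq' (abs_le.1 (abs_perp_le hM i j)).1 (abs_le.1 (abs_perp_le hM i j)).2
  refine h.trans (le_of_eq ?_)
  simp only [Finset.sum_const, Finset.card_univ, Fintype.card_fin, nsmul_eq_mul]
  ring

theorem sum_perp_perm (hn : n ≠ 0) (x : Fin n → Fin n → ℝ) (s : Equiv.Perm (Fin n)) :
    ∑ i, perp x i (s i) = ∑ i, x i (s i) - entrySum x / n := by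
  have hn' : (n : ℝ) ≠ 0 := by exact_mod_cast hn
  simp only [perp, Finset.sum_add_distrib, Finset.sum_sub_distrib, ← Finset.sum_div,
    sum_rowSum, Equiv.sum_comp s (colSum x), sum_colSum, Finset.sum_const, Finset.card_univ,
    Fintype.card_fin, nsmul_eq_mul]
  field_simp
  ring

/-- Relabelling the columns by `s` makes the schedule diagonal. The sign lets the part of the drift
of `perp` with factor `1 - r` be dropped. -/
theorem served_perp_nonneg (hn : n ≠ 0) {x : Fin n → Fin n → ℝ} (hx : ∀ i j, 0 ≤ x i j)
    {s : Equiv.Perm (Fin n)}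
    (hM : ∀ σ : Equiv.Perm (Fin n), ∑ i, x i (σ i) ≤ ∑ i, x i (s i)) :
    0 ≤ ∑ i with x i (s i) ≠ 0, perp x i (s i) := by
  have hn' : (0 : ℝ) < n := by exact_mod_cast hn.bot_lt
  have h := served_diag_nonneg (x := fun i j => x i (s j)) (fun i j => hx i (s j))
    (fun σ => hM (σ.trans s)) (Finset.univ.filter fun i => x i (s i) ≠ 0) (by simp)
  set J := Finset.univ.filter fun i => x i (s i) ≠ 0
  have h1 : ∀ i, ∑ j, x i (s j) = rowSum x i := fun i => Equiv.sum_comp s (x i)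
  have h2 : ∑ i, ∑ j, x i (s j) = entrySum x := by simp only [h1, sum_rowSum]
  have h3 : ∀ j, ∑ i, x i (s j) = colSum x (s j) := fun j => rfl
  rw [h2, Fintype.card_fin] at h
  simp only [h1, h3] at h
  have e : (n : ℝ) ^ 2 * ∑ i ∈ J, perp x i (s i) = n ^ 2 * ∑ i ∈ J, x i (s i)
      + J.card * entrySum x - n * (∑ i ∈ J, rowSum x i + ∑ i ∈ J, colSum x (s i)) := by
    simp only [perp, Finset.sum_add_distrib, Finset.sum_sub_distrib, ← Finset.sum_div,
      Finset.sum_const, nsmul_eq_mul]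
    field_simp
    ring
  have h4 : 0 ≤ (n : ℝ) ^ 2 * ∑ i ∈ J, perp x i (s i) := by linarith
  exact nonneg_of_mul_nonneg_right h4 (by positivity)

end Projection

/-! ### One step of the switch -/

theorem mean_finsetSum {α ι : Type*} {p : PMF α} (hp : p.support.Finite) (s : Finset ι)
    (f : ι → α → ℝ) : mean p (fun x => ∑ i ∈ s, f i x) = ∑ i ∈ s, mean p (f i) := by
  simp only [mean_eq_sum hp, Finset.mul_sum]
  exact Finset.sum_comm

section Step

variable {n : ℕ}

/-- The matrix of arrivals. -/
def arrivalMat (a : Arrivals n) (i j : Fin n) : ℝ := if a i j then 1 else 0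

/-- The permutation matrix of a schedule. -/
def scheduleMat (s : Schedule n) (i j : Fin n) : ℝ := if s i = j then 1 else 0

/-- The matrix of unused service: `s` serves an empty queue at which no packet arrives. -/
def idleMat (q : QueueState n) (a : Arrivals n) (s : Schedule n) (i j : Fin n) : ℝ :=
  scheduleMat s i j * (if q i j = 0 then 1 else 0) * (1 - arrivalMat a i j)

/-- The matrix of queue lengths, as real numbers. -/
def queueMat (q : QueueState n) (i j : Fin n) : ℝ := q i j

/-- The increment of the queue lengths in one slot. -/
def incrementMat (q : QueueState n) (a : Arrivals n) (s : Schedule n) : Fin n → Fin n → ℝ :=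
  fun i j => arrivalMat a i j - scheduleMat s i j + idleMat q a s i j

theorem queueMat_nextQueue (q : QueueState n) (a : Arrivals n) (s : Schedule n) :
    queueMat (nextQueue q a s) = queueMat q + incrementMat q a s := by
  funext i j
  simp only [queueMat, nextQueue, incrementMat, idleMat, arrivalMat, scheduleMat, Pi.add_apply]
  by_cases ha : a i j = true <;> by_cases hs : s i = j <;> by_cases hq : q i j = 0 <;>
    simp [ha, hs, hq]
  rw [Nat.cast_sub (Nat.one_le_iff_ne_zero.2 hq)]
  simp [sub_eq_add_neg]

theorem queueMat_nonneg (q : QueueState n) (i j : Fin n) : 0 ≤ queueMat q i j := Nat.cast_nonneg _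

/-- Complementary slackness: unused service at a queue means that the queue is empty in the next
slot. -/
theorem idleMat_mul_next (q : QueueState n) (a : Arrivals n) (s : Schedule n) (i j : Fin n) :
    idleMat q a s i j * queueMat (nextQueue q a s) i j = 0 := by
  simp only [queueMat, nextQueue, idleMat, arrivalMat, scheduleMat]
  by_cases ha : a i j = true <;> by_cases hs : s i = j <;> by_cases hq : q i j = 0 <;>
    simp [ha, hs, hq]

theorem idleMat_sq (q : QueueState n) (a : Arrivals n) (s : Schedule n) (i j : Fin n) :
    idleMat q a s i j ^ 2 = idleMat q a s i j := by
  simp only [idleMat, arrivalMat, scheduleMat]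
  split_ifs <;> simp

theorem sqSum_incrementMat_le (q : QueueState n) (a : Arrivals n) (s : Schedule n) :
    sqSum (incrementMat q a s) ≤ n ^ 2 := by
  have h : sqSum (incrementMat q a s) ≤ ∑ _i : Fin n, ∑ _j : Fin n, (1 : ℝ) := by
    refine Finset.sum_le_sum fun i _ => Finset.sum_le_sum fun j _ => ?_
    simp only [incrementMat, idleMat, arrivalMat, scheduleMat]
    split_ifs <;> simp
  refine h.trans (le_of_eq ?_)
  simp only [Finset.sum_const, Finset.card_univ, Fintype.card_fin, nsmul_eq_mul]
  ring

theorem sum_mul_scheduleMat (c : Fin n → Fin n → ℝ) (s : Schedule n) :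
    ∑ i, ∑ j, c i j * scheduleMat s i j = ∑ i, c i (s i) := by
  simp [scheduleMat]

theorem rowSum_scheduleMat (s : Schedule n) (i : Fin n) : rowSum (scheduleMat s) i = 1 := by
  simp [rowSum, scheduleMat]

theorem colSum_scheduleMat (s : Schedule n) (j : Fin n) : colSum (scheduleMat s) j = 1 := by
  simp only [colSum, scheduleMat, ← Equiv.eq_symm_apply]
  simp

theorem finite_support_of_fintype {α : Type*} [Finite α] (p : PMF α) : p.support.Finite :=
  Set.toFinite _

theorem mem_support_step {rate : Fin n → Fin n → unitInterval}
    {policy : QueueState n → PMF (Schedule n)} {q q' : QueueState n} :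
    q' ∈ (step rate policy q).support ↔ ∃ s ∈ (policy q).support,
      ∃ a ∈ (arrivalLaw rate).support, nextQueue q a s = q' := by
  simp only [step, PMF.mem_support_bind_iff, PMF.mem_support_map_iff]

theorem finite_support_step (rate : Fin n → Fin n → unitInterval)
    (policy : QueueState n → PMF (Schedule n)) (q : QueueState n) :
    (step rate policy q).support.Finite := by
  refine (Set.finite_range fun z : Schedule n × Arrivals n => nextQueue q z.2 z.1).subset ?_
  intro q' hq'
  obtain ⟨s, _, a, _, rfl⟩ := mem_support_step.1 hq'
  exact ⟨(s, a), rfl⟩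

theorem mean_step (rate : Fin n → Fin n → unitInterval)
    (policy : QueueState n → PMF (Schedule n)) (q : QueueState n) (F : QueueState n → ℝ) :
    mean (step rate policy q) F
      = mean (policy q) fun s => mean (arrivalLaw rate) fun a => F (nextQueue q a s) := by
  obtain ⟨B, hB⟩ := exists_bound_of_finite (finite_support_step rate policy q) F
  rw [step, mean_bind _ _ hB]
  congr 1
  funext s
  obtain ⟨B', hB'⟩ := exists_bound_of_finite (finite_support_of_fintype (arrivalLaw rate))
    fun a => F (nextQueue q a s)
  rw [mean_map _ _ hB']

/-! ### Moments of the arrivals -/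

/-- Independence of the arrivals; the first and second moments follow by taking `g` equal to 1 away
from one or two pairs. -/
theorem mean_arrivalLaw_prod (rate : Fin n → Fin n → unitInterval)
    (g : Fin n × Fin n → Bool → ℝ) :
    mean (arrivalLaw rate) (fun a => ∏ z : Fin n × Fin n, g z (a z.1 z.2))
      = ∏ z : Fin n × Fin n, ((rate z.1 z.2 : ℝ) * g z true
          + (1 - (rate z.1 z.2 : ℝ)) * g z false) := by
  have e : ∀ a : Arrivals n, (arrivalLaw rate a).toReal * ∏ z : Fin n × Fin n, g z (a z.1 z.2)
      = ∏ i, ∏ j, ((if a i j then (rate i j : ℝ) else 1 - (rate i j : ℝ)) * g (i, j) (a i j)) := by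
    intro a
    rw [arrivalLaw, PMF.ofFintype_apply, Fintype.prod_prod_type]
    simp only [ENNReal.toReal_prod, Finset.prod_mul_distrib]
    congr 1
    refine Finset.prod_congr rfl fun i _ => Finset.prod_congr rfl fun j _ => ?_
    rw [ENNReal.toReal_ofReal]
    have h0 := (rate i j).2.1
    have h1 := (rate i j).2.2
    split_ifs
    · exact h0
    · linarith
  rw [mean, tsum_fintype, Finset.sum_congr rfl fun a _ => e a, Fintype.prod_prod_type]
  have h := Fintype.prod_sum (fun (i : Fin n) (b : Fin n → Bool) =>
    ∏ j, ((if b j then (rate i j : ℝ) else 1 - (rate i j : ℝ)) * g (i, j) (b j)))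
  rw [← h]
  refine Finset.prod_congr rfl fun i _ => ?_
  have h' := Fintype.prod_sum (fun (j : Fin n) (c : Bool) =>
    (if c then (rate i j : ℝ) else 1 - (rate i j : ℝ)) * g (i, j) c)
  rw [← h']
  refine Finset.prod_congr rfl fun j _ => ?_
  rw [Fintype.sum_bool]
  simp

theorem mean_arrivalMat (rate : Fin n → Fin n → unitInterval) (i j : Fin n) :
    mean (arrivalLaw rate) (fun a => arrivalMat a i j) = rate i j := by
  have h := mean_arrivalLaw_prod rate fun z b => if z = (i, j) then (if b then 1 else 0) else 1
  have e : ∀ a : Arrivals n, ∏ z : Fin n × Fin n,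
      (if z = (i, j) then (if a z.1 z.2 then (1 : ℝ) else 0) else 1) = arrivalMat a i j := by
    intro a
    rw [Finset.prod_ite_eq' Finset.univ (i, j) fun z => if a z.1 z.2 then (1 : ℝ) else 0]
    simp [arrivalMat]
  simp only [e] at h
  rw [h, Finset.prod_eq_single (i, j)]
  · simp
  · intro z _ hz
    simp [hz]
  · simp

theorem mean_arrivalMat_mul (rate : Fin n → Fin n → unitInterval) {z w : Fin n × Fin n}
    (hzw : z ≠ w) :
    mean (arrivalLaw rate) (fun a => arrivalMat a z.1 z.2 * arrivalMat a w.1 w.2)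
      = rate z.1 z.2 * rate w.1 w.2 := by
  have h := mean_arrivalLaw_prod rate fun y b => if y = z ∨ y = w then (if b then 1 else 0) else 1
  have e : ∀ a : Arrivals n, ∏ y : Fin n × Fin n,
      (if y = z ∨ y = w then (if a y.1 y.2 then (1 : ℝ) else 0) else 1)
        = arrivalMat a z.1 z.2 * arrivalMat a w.1 w.2 := by
    intro a
    rw [Fintype.prod_eq_mul z w hzw]
    · simp [arrivalMat]
    · rintro y ⟨h1, h2⟩
      simp [h1, h2]
  simp only [e] at h
  rw [h, Fintype.prod_eq_mul z w hzw]
  · simp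
  · rintro y ⟨h1, h2⟩
    simp [h1, h2]

theorem mean_centred_mul {rate : Fin n → Fin n → unitInterval} {r : ℝ}
    (hr : ∀ i j, (rate i j : ℝ) = r) (z w : Fin n × Fin n) :
    mean (arrivalLaw rate) (fun a => (arrivalMat a z.1 z.2 - r) * (arrivalMat a w.1 w.2 - r))
      = if z = w then r * (1 - r) else 0 := by
  have hp := finite_support_of_fintype (arrivalLaw rate)
  have e : ∀ a : Arrivals n, (arrivalMat a z.1 z.2 - r) * (arrivalMat a w.1 w.2 - r)
      = arrivalMat a z.1 z.2 * arrivalMat a w.1 w.2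
        + ((-r) * arrivalMat a z.1 z.2 + ((-r) * arrivalMat a w.1 w.2 + r ^ 2)) := fun a => by ring
  simp only [e]
  rw [mean_add hp, mean_add hp, mean_add hp, mean_mul_left, mean_mul_left, mean_const,
    mean_arrivalMat, mean_arrivalMat, hr, hr]
  split_ifs with h
  · subst h
    have e2 : ∀ a : Arrivals n, arrivalMat a z.1 z.2 * arrivalMat a z.1 z.2
        = arrivalMat a z.1 z.2 := by
      intro a
      simp only [arrivalMat]
      split_ifs <;> simp
    simp only [e2]
    rw [mean_arrivalMat, hr]
    ring
  · rw [mean_arrivalMat_mul rate h, hr, hr]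
    ring

/-- The second moment of an affine function of the arrivals. -/
theorem mean_sq_affine {rate : Fin n → Fin n → unitInterval} {r : ℝ}
    (hr : ∀ i j, (rate i j : ℝ) = r) (c : Fin n → Fin n → ℝ) (e : ℝ) :
    mean (arrivalLaw rate) (fun a => (∑ i, ∑ j, c i j * arrivalMat a i j - e) ^ 2)
      = r * (1 - r) * sqSum c + (r * entrySum c - e) ^ 2 := by
  have hp := finite_support_of_fintype (arrivalLaw rate)
  have hc : ∀ a : Arrivals n, ∑ i, ∑ j, c i j * arrivalMat a i j
      = ∑ z : Fin n × Fin n, c z.1 z.2 * (arrivalMat a z.1 z.2 - r) + r * entrySum c := by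
    intro a
    rw [Fintype.sum_prod_type]
    simp only [mul_sub, Finset.sum_sub_distrib, ← Finset.sum_mul, entrySum]
    ring
  have h : ∀ a : Arrivals n, (∑ i, ∑ j, c i j * arrivalMat a i j - e) ^ 2
      = ∑ z : Fin n × Fin n, ∑ w : Fin n × Fin n, c z.1 z.2 * c w.1 w.2
          * ((arrivalMat a z.1 z.2 - r) * (arrivalMat a w.1 w.2 - r))
        + (2 * (r * entrySum c - e) * ∑ z : Fin n × Fin n, c z.1 z.2 * (arrivalMat a z.1 z.2 - r)
        + (r * entrySum c - e) ^ 2) := by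
    intro a
    have h1 : ∑ z : Fin n × Fin n, ∑ w : Fin n × Fin n, c z.1 z.2 * c w.1 w.2
          * ((arrivalMat a z.1 z.2 - r) * (arrivalMat a w.1 w.2 - r))
        = (∑ z : Fin n × Fin n, c z.1 z.2 * (arrivalMat a z.1 z.2 - r)) ^ 2 := by
      rw [sq, Finset.sum_mul_sum]
      exact Finset.sum_congr rfl fun z _ => Finset.sum_congr rfl fun w _ => by ring
    rw [h1, hc]
    ring
  simp only [h]
  rw [mean_add hp, mean_add hp, mean_const, mean_mul_left, mean_finsetSum hp, mean_finsetSum hp]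
  simp only [mean_finsetSum hp, mean_mul_left, mean_sub hp, mean_const, mean_arrivalMat, hr,
    mean_centred_mul hr]
  simp only [sub_self, mul_zero, Finset.sum_const_zero, zero_add, mul_ite, Finset.sum_ite_eq,
    Finset.mem_univ, if_true, ← Finset.sum_mul]
  rw [Fintype.sum_prod_type]
  simp only [sqSum, ← sq]
  ring

theorem mean_arrival_affine {rate : Fin n → Fin n → unitInterval} {r : ℝ}
    (hr : ∀ i j, (rate i j : ℝ) = r) (c : Fin n → Fin n → ℝ) :
    mean (arrivalLaw rate) (fun a => ∑ i, ∑ j, c i j * arrivalMat a i j) = r * entrySum c := by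
  have hp := finite_support_of_fintype (arrivalLaw rate)
  simp only [mean_finsetSum hp, mean_mul_left, mean_arrivalMat, hr, ← Finset.sum_mul]
  rw [mul_comm]
  rfl

/-- The mean of a linear function of the increment. -/
theorem mean_increment {rate : Fin n → Fin n → unitInterval} {r : ℝ}
    (hr : ∀ i j, (rate i j : ℝ) = r) (q : QueueState n) (s : Schedule n)
    (c : Fin n → Fin n → ℝ) :
    mean (arrivalLaw rate) (fun a => ∑ i, ∑ j, c i j * incrementMat q a s i j)
      = r * entrySum c - r * ∑ i, c i (s i) - (1 - r) * ∑ i with q i (s i) ≠ 0, c i (s i) := by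
  have hp := finite_support_of_fintype (arrivalLaw rate)
  simp only [incrementMat, idleMat, mean_finsetSum hp, mean_mul_left, mean_add hp, mean_sub hp,
    mean_const, mean_arrivalMat, hr]
  -- Service at an empty queue acts only if a packet arrives, so it has effect `r` on average; the
  -- other `1 - r` is effective only at nonempty queues.
  have e : ∀ i j, c i j * (r - scheduleMat s i j
      + scheduleMat s i j * (if q i j = 0 then 1 else 0) * (1 - r))
      = r * c i j - r * (c i j * scheduleMat s i j)
        - (1 - r) * ((if q i j ≠ 0 then c i j else 0) * scheduleMat s i j) := by
    intro i j
    by_cases h : q i j = 0 <;> simp only [h, ne_eq, not_true, not_false_iff, if_true, if_false] <;>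
      ring
  simp only [e, Finset.sum_sub_distrib, ← Finset.mul_sum, sum_mul_scheduleMat]
  rw [Finset.sum_filter]
  rfl

end Step

/-! ### Drift of the switch under MaxWeight -/

section Drift

variable {n : ℕ}

theorem sum_mul_sq_le (x y : Fin n → Fin n → ℝ) :
    (∑ i, ∑ j, x i j * y i j) ^ 2 ≤ sqSum x * sqSum y := by
  have h := Finset.sum_mul_sq_le_sq_mul_sq Finset.univ
    (fun z : Fin n × Fin n => x z.1 z.2) (fun z => y z.1 z.2)
  simp only [Fintype.sum_prod_type] at h
  exact h

/-- The increment is `2 ⟨x, y⟩ + ‖y‖²`; Cauchy–Schwarz bounds its square by `8 B ‖x‖² + 2 B²`. One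
constant serves as both coefficients, as `RootDrift` requires. -/
theorem sqSum_add_sub_sq_le {x y : Fin n → Fin n → ℝ} {B : ℝ} (hB : sqSum y ≤ B) :
    (sqSum (x + y) - sqSum x) ^ 2 ≤ (8 * B + 2 * B ^ 2) * sqSum x + (8 * B + 2 * B ^ 2) := by
  have h1 := sum_mul_sq_le x y
  have hx := sqSum_nonneg x
  have hy := sqSum_nonneg y
  have h2 : sqSum x * sqSum y ≤ sqSum x * B := mul_le_mul_of_nonneg_left hB hx
  have h3 : sqSum y ^ 2 ≤ B ^ 2 := pow_le_pow_left₀ hy hB 2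
  rw [sqSum_add]
  set I := ∑ i, ∑ j, x i j * y i j
  have h4 : (sqSum x + 2 * I + sqSum y - sqSum x) ^ 2 ≤ 8 * I ^ 2 + 2 * sqSum y ^ 2 := by
    nlinarith [sq_nonneg (2 * I - sqSum y)]
  have h5 : 0 ≤ B ^ 2 * sqSum x := by positivity
  have h6 : 0 ≤ B := hy.trans hB
  nlinarith

theorem IsMaxWeight.sum_le {policy : QueueState n → PMF (Schedule n)} (h : IsMaxWeight policy)
    {q : QueueState n} {s : Schedule n} (hs : s ∈ (policy q).support) (σ : Equiv.Perm (Fin n)) :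
    ∑ i, queueMat q i (σ i) ≤ ∑ i, queueMat q i (s i) := by
  have h1 := h q s hs σ
  simp only [weight] at h1
  simp only [queueMat]
  exact_mod_cast h1

theorem sum_served (q : QueueState n) (s : Schedule n) :
    ∑ i with q i (s i) ≠ 0, queueMat q i (s i) = ∑ i, queueMat q i (s i) := by
  rw [Finset.sum_filter]
  refine Finset.sum_congr rfl fun i _ => ?_
  by_cases h : q i (s i) = 0 <;> simp [h, queueMat]

theorem sqrt_sqSum_le {x : Fin n → Fin n → ℝ} (hx : ∀ i j, 0 ≤ x i j) :
    √(sqSum x) ≤ entrySum x := by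
  have h0 : 0 ≤ entrySum x := Finset.sum_nonneg fun i _ => Finset.sum_nonneg fun j _ => hx i j
  refine Real.sqrt_le_iff.2 ⟨h0, ?_⟩
  rw [sq (entrySum x)]
  nth_rewrite 1 [entrySum]
  simp only [Finset.sum_mul, sqSum]
  refine Finset.sum_le_sum fun i _ => Finset.sum_le_sum fun j _ => ?_
  rw [sq]
  refine mul_le_mul_of_nonneg_left ?_ (hx i j)
  exact (Finset.single_le_sum (fun l _ => hx i l) (Finset.mem_univ j)).trans
    (Finset.single_le_sum (f := fun k => ∑ l, x k l)
      (fun k _ => Finset.sum_nonneg fun l _ => hx k l) (Finset.mem_univ i))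

variable {rate : Fin n → Fin n → unitInterval} {r : ℝ}
  {policy : QueueState n → PMF (Schedule n)}

theorem mean_step_le {q : QueueState n} {F : QueueState n → ℝ} {b : ℝ}
    (h : ∀ s ∈ (policy q).support,
      mean (arrivalLaw rate) (fun a => F (nextQueue q a s)) ≤ b) :
    mean (step rate policy q) F ≤ b := by
  rw [mean_step, ← mean_const (policy q) b]
  exact mean_mono (finite_support_of_fintype _) h

/-- The total squared queue length has negative drift below capacity. -/
theorem rootDrift_sqSum (hn : n ≠ 0) (hr : ∀ i j, (rate i j : ℝ) = r) (hr1 : r * n ≤ 1)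
    (hpolicy : IsMaxWeight policy) :
    RootDrift (step rate policy) (fun q => sqSum (queueMat q)) (2 * (1 - r * n) / n) (n ^ 2)
      (8 * n ^ 2 + 2 * (n ^ 2) ^ 2) := by
  have hn' : (0 : ℝ) < n := by exact_mod_cast hn.bot_lt
  refine ⟨fun q => sqSum_nonneg _, fun q => mean_step_le fun s hs => ?_, fun q q' hq' => ?_⟩
  · have hp := finite_support_of_fintype (arrivalLaw rate)
    have h1 : mean (arrivalLaw rate) (fun a => sqSum (queueMat (nextQueue q a s)))
        ≤ mean (arrivalLaw rate) (fun a => sqSum (queueMat q)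
          + (2 * ∑ i, ∑ j, queueMat q i j * incrementMat q a s i j + n ^ 2)) := by
      refine mean_mono hp fun a _ => ?_
      rw [queueMat_nextQueue, sqSum_add, add_assoc]
      gcongr
      exact sqSum_incrementMat_le q a s
    -- Paired with the queue lengths, both service sums equal `M`, so the linear term is `2 (r T -
    -- M)`, and `M ≥ T / n`.
    rw [mean_add hp, mean_add hp, mean_const, mean_const, mean_mul_left, mean_increment hr,
      sum_served] at h1
    have h2 := sum_le_card_mul (hpolicy.sum_le hs)
    rw [Fintype.card_fin] at h2
    have h3 := sqrt_sqSum_le (queueMat_nonneg q)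
    change entrySum (queueMat q) ≤ _ at h2
    set M := ∑ i, queueMat q i (s i)
    set T := entrySum (queueMat q)
    have h4 : T / n ≤ M := by rw [div_le_iff₀ hn']; linarith
    have h5 : 2 * (1 - r * n) / n * √(sqSum (queueMat q)) ≤ 2 * (1 - r * n) / n * T := by
      refine mul_le_mul_of_nonneg_left h3 (div_nonneg ?_ hn'.le)
      linarith
    have h6 : 2 * (1 - r * n) / n * T = 2 * (T / n) - 2 * r * T := by
      field_simp
    linarith
  · obtain ⟨s, _, a, _, rfl⟩ := mem_support_step.1 hq'
    rw [queueMat_nextQueue]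
    exact sqSum_add_sub_sq_le (sqSum_incrementMat_le q a s)

/-- The component orthogonal to the margins has negative drift, uniformly in the load. -/
theorem rootDrift_perp (hn : n ≠ 0) (hr : ∀ i j, (rate i j : ℝ) = r) (hr0 : 0 ≤ r) (hr1 : r ≤ 1)
    (hpolicy : IsMaxWeight policy) {δ : ℝ} (hδ : δ ≤ 2 * r / n ^ 2) :
    RootDrift (step rate policy) (fun q => sqSum (perp (queueMat q))) δ (n ^ 2)
      (8 * n ^ 2 + 2 * (n ^ 2) ^ 2) := by
  have hn' : (0 : ℝ) < n := by exact_mod_cast hn.bot_lt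
  refine ⟨fun q => sqSum_nonneg _, fun q => mean_step_le fun s hs => ?_, fun q q' hq' => ?_⟩
  · have hp := finite_support_of_fintype (arrivalLaw rate)
    have h1 : mean (arrivalLaw rate) (fun a => sqSum (perp (queueMat (nextQueue q a s))))
        ≤ mean (arrivalLaw rate) (fun a => sqSum (perp (queueMat q))
          + (2 * ∑ i, ∑ j, perp (queueMat q) i j * incrementMat q a s i j + n ^ 2)) := by
      refine mean_mono hp fun a _ => ?_
      rw [queueMat_nextQueue, sqSum_perp_add, add_assoc]
      gcongr
      exact (sqSum_perp_le _).trans (sqSum_incrementMat_le q a s)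
    -- The linear term becomes `-2 r (M - T / n)` minus `2 (1 - r)` times the served part of `perp`,
    -- which is nonnegative.
    rw [mean_add hp, mean_add hp, mean_const, mean_const, mean_mul_left, mean_increment hr,
      entrySum_perp, sum_perp_perm hn] at h1
    have h2 := served_perp_nonneg hn (queueMat_nonneg q) (hpolicy.sum_le hs)
    have e : ∑ i with queueMat q i (s i) ≠ 0, perp (queueMat q) i (s i)
        = ∑ i with q i (s i) ≠ 0, perp (queueMat q) i (s i) := by
      simp only [queueMat, ne_eq, Nat.cast_eq_zero]
    rw [e] at h2
    have h3 := sqrt_sqSum_perp_le hn (hpolicy.sum_le hs)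
    set M := ∑ i, queueMat q i (s i)
    set T := entrySum (queueMat q)
    set R := √(sqSum (perp (queueMat q)))
    have h4 : δ * R ≤ 2 * r / n ^ 2 * R := mul_le_mul_of_nonneg_right hδ (Real.sqrt_nonneg _)
    have h5 : 2 * r / n ^ 2 * R ≤ 2 * r / n ^ 2 * (n * (n * M - T)) :=
      mul_le_mul_of_nonneg_left h3 (by positivity)
    have h6 : 2 * r / n ^ 2 * (n * (n * M - T)) = 2 * (r * (M - T / n)) := by
      field_simp
    have h7 := mul_nonneg (sub_nonneg.2 hr1) h2
    linarith
  · obtain ⟨s, _, a, _, rfl⟩ := mem_support_step.1 hq'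
    rw [queueMat_nextQueue, perp_add]
    exact sqSum_add_sub_sq_le ((sqSum_perp_le _).trans (sqSum_incrementMat_le q a s))

/-! ### Accessibility of the empty state -/

theorem finite_sqSum_le (M : ℝ) : {q : QueueState n | sqSum (queueMat q) ≤ M}.Finite := by
  refine (Set.finite_Icc (0 : QueueState n) fun _ _ => ⌊M⌋₊).subset fun q hq => ?_
  refine ⟨fun i j => Nat.zero_le _, fun i j => Nat.le_floor ?_⟩
  have h1 : (q i j : ℝ) ≤ (q i j : ℝ) ^ 2 := by
    exact_mod_cast Nat.le_self_pow two_ne_zero (q i j)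
  have h2 : queueMat q i j ^ 2 ≤ sqSum (queueMat q) :=
    (Finset.single_le_sum (f := fun j => queueMat q i j ^ 2) (fun _ _ => sq_nonneg _)
      (Finset.mem_univ j)).trans
    (Finset.single_le_sum (f := fun i => ∑ j, queueMat q i j ^ 2)
      (fun _ _ => Finset.sum_nonneg fun _ _ => sq_nonneg _) (Finset.mem_univ i))
  exact h1.trans (h2.trans hq)

theorem no_arrivals_mem_support (hr : ∀ i j, (rate i j : ℝ) = r) (hr1 : r < 1) :
    (fun _ _ => false : Arrivals n) ∈ (arrivalLaw rate).support := by
  rw [arrivalLaw, PMF.mem_support_ofFintype_iff]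
  refine Finset.prod_ne_zero_iff.2 fun i _ => Finset.prod_ne_zero_iff.2 fun j _ => ?_
  simp [hr, hr1]

theorem step_zero (hr : ∀ i j, (rate i j : ℝ) = r) (hr1 : r < 1) :
    (0 : QueueState n) ∈ (step rate policy 0).support := by
  obtain ⟨s, hs⟩ := (policy 0).support_nonempty
  refine mem_support_step.2 ⟨s, hs, _, no_arrivals_mem_support hr hr1, ?_⟩
  funext i j
  simp [nextQueue]

theorem exists_step_lt (hr : ∀ i j, (rate i j : ℝ) = r) (hr1 : r < 1)
    (hpolicy : IsMaxWeight policy) (q : QueueState n) (hq : q ≠ 0) :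
    ∃ q' ∈ (step rate policy q).support, ∑ i, ∑ j, q' i j < ∑ i, ∑ j, q i j := by
  obtain ⟨s, hs⟩ := (policy q).support_nonempty
  refine ⟨_, mem_support_step.2 ⟨s, hs, _, no_arrivals_mem_support hr hr1, rfl⟩, ?_⟩
  obtain ⟨i, j, hij⟩ : ∃ i j, q i j ≠ 0 := by
    by_contra h
    push Not at h
    exact hq (funext fun i => funext fun j => h i j)
  -- A schedule serving only empty queues has weight 0 and is beaten by a transposition that serves
  -- `(i, j)`.
  obtain ⟨k, hk⟩ : ∃ k, q k (s k) ≠ 0 := by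
    by_contra h
    push Not at h
    have h1 := hpolicy q s hs (Equiv.swap i j)
    have h2 : weight q s = 0 := Finset.sum_eq_zero fun k _ => h k
    have h3 : q i (Equiv.swap i j i) ≤ weight q (Equiv.swap i j) :=
      Finset.single_le_sum (f := fun k => q k (Equiv.swap i j k)) (fun _ _ => Nat.zero_le _)
        (Finset.mem_univ i)
    rw [Equiv.swap_apply_left] at h3
    omega
  have hle : ∀ i j, nextQueue q (fun _ _ => false) s i j ≤ q i j := by
    intro i j
    simp [nextQueue]
  refine Finset.sum_lt_sum (fun i _ => Finset.sum_le_sum fun j _ => hle i j)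
    ⟨k, Finset.mem_univ k, Finset.sum_lt_sum (fun j _ => hle k j) ⟨s k, Finset.mem_univ _, ?_⟩⟩
  simp only [nextQueue]
  simp
  omega

end Drift

/-! ### Drift of the margin form -/

section MarginDrift

variable {n : ℕ}

theorem entrySum_scheduleMat (s : Schedule n) : entrySum (scheduleMat s) = n := by
  simp [← sum_rowSum, rowSum_scheduleMat]

theorem rowSum_sub (x y : Fin n → Fin n → ℝ) (i : Fin n) :
    rowSum (x - y) i = rowSum x i - rowSum y i := Finset.sum_sub_distrib _ _

theorem colSum_sub (x y : Fin n → Fin n → ℝ) (i : Fin n) :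
    colSum (x - y) i = colSum x i - colSum y i := Finset.sum_sub_distrib _ _

theorem entrySum_sub (x y : Fin n → Fin n → ℝ) :
    entrySum (x - y) = entrySum x - entrySum y := by
  simp only [← sum_rowSum, rowSum_sub, Finset.sum_sub_distrib]

theorem incrementMat_eq (q : QueueState n) (a : Arrivals n) (s : Schedule n) :
    incrementMat q a s = (arrivalMat a - scheduleMat s) + idleMat q a s := rfl

theorem marginInner_add_self (x u : Fin n → Fin n → ℝ) :
    marginInner (x + u) u = marginInner x u + marginForm u := by
  simp only [marginInner, marginForm, rowSum_add, colSum_add, entrySum_add, add_mul,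
    Finset.sum_add_distrib, sq]
  ring

/-- The margin inner product as a linear function of its second argument. -/
theorem marginInner_eq_sum (x y : Fin n → Fin n → ℝ) :
    marginInner x y
      = ∑ i, ∑ j, (rowSum x i + colSum x j - entrySum x / n) * y i j := by
  have h1 : ∑ i, ∑ j, rowSum x i * y i j = ∑ i, rowSum x i * rowSum y i := by
    simp only [← Finset.mul_sum, rowSum]
  have h2 : ∑ i, ∑ j, colSum x j * y i j = ∑ j, colSum x j * colSum y j := by
    rw [Finset.sum_comm]
    simp only [← Finset.mul_sum, colSum]
  have h3 : ∑ i, ∑ j, entrySum x / n * y i j = entrySum x * entrySum y / n := by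
    simp only [← Finset.mul_sum]
    rw [div_mul_eq_mul_div]
    rfl
  simp only [add_mul, sub_mul, Finset.sum_add_distrib, Finset.sum_sub_distrib, h1, h2, h3,
    marginInner]

/-- The next value of the margin form, in terms of the unused service. -/
theorem marginForm_next (q : QueueState n) (a : Arrivals n) (s : Schedule n) :
    marginForm (queueMat (nextQueue q a s))
      = marginForm (queueMat q) + 2 * marginInner (queueMat q) (arrivalMat a - scheduleMat s)
        + marginForm (arrivalMat a - scheduleMat s)
        + (2 * marginInner (queueMat (nextQueue q a s)) (idleMat q a s)
          - marginForm (idleMat q a s)) := by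
  -- The inner product with the unused service is taken at the next state, where the supports are
  -- disjoint; this turns `+ marginForm u` into `- marginForm u`.
  rw [queueMat_nextQueue, incrementMat_eq, ← add_assoc, marginInner_add_self, marginForm_add,
    marginForm_add]
  ring

/-- Expresses the unused service through the change of the total queue, whose stationary mean is
zero. -/
theorem entrySum_idleMat (q : QueueState n) (a : Arrivals n) (s : Schedule n) :
    entrySum (idleMat q a s) = entrySum (queueMat (nextQueue q a s)) - entrySum (queueMat q)
      - entrySum (arrivalMat a) + n := by
  rw [queueMat_nextQueue, incrementMat_eq, entrySum_add, entrySum_add, entrySum_sub,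
    entrySum_scheduleMat]
  ring

theorem sqSum_idleMat (q : QueueState n) (a : Arrivals n) (s : Schedule n) :
    sqSum (idleMat q a s) = entrySum (idleMat q a s) := by
  simp only [sqSum, entrySum, idleMat_sq]

theorem abs_idle_le (hn : n ≠ 0) (q : QueueState n) (a : Arrivals n) (s : Schedule n) {η : ℝ}
    (hη : 0 < η) :
    |2 * marginInner (queueMat (nextQueue q a s)) (idleMat q a s) - marginForm (idleMat q a s)|
      ≤ (n / η + n) * entrySum (idleMat q a s)
        + n * η * sqSum (perp (queueMat (nextQueue q a s))) := by
  have h1 := marginForm_nonneg hn (idleMat q a s)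
  have h2 := marginForm_le hn (idleMat q a s)
  rw [sqSum_idleMat] at h2
  set u := idleMat q a s with hu
  set y := queueMat (nextQueue q a s)
  have h3 : marginInner y u = -(n * ∑ i, ∑ j, u i j * perp y i j) :=
    marginInner_of_disjoint hn fun i j => idleMat_mul_next q a s i j
  -- AM-GM with weight `η`, entry by entry; `u² = u` makes the first term linear in `u`.
  have h4 : |2 * ∑ i, ∑ j, u i j * perp y i j| ≤ entrySum u / η + η * sqSum (perp y) := by
    have e : entrySum u / η + η * sqSum (perp y)
        = ∑ i, ∑ j, (u i j / η + η * perp y i j ^ 2) := by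
      simp only [entrySum, sqSum, Finset.sum_add_distrib, Finset.mul_sum, Finset.sum_div]
    rw [e]
    simp only [Finset.mul_sum]
    refine (Finset.abs_sum_le_sum_abs _ _).trans (Finset.sum_le_sum fun i _ =>
      (Finset.abs_sum_le_sum_abs _ _).trans (Finset.sum_le_sum fun j _ => ?_))
    have h5 : u i j ^ 2 = u i j := idleMat_sq q a s i j
    have h6 : u i j / η + η * perp y i j ^ 2 - 2 * (u i j * perp y i j)
        = (u i j - η * perp y i j) ^ 2 / η := by
      nth_rewrite 1 [← h5]
      field_simp
      ring
    have h7 : u i j / η + η * perp y i j ^ 2 + 2 * (u i j * perp y i j)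
        = (u i j + η * perp y i j) ^ 2 / η := by
      nth_rewrite 1 [← h5]
      field_simp
      ring
    have h8 : 0 ≤ (u i j - η * perp y i j) ^ 2 / η := by positivity
    have h9 : 0 ≤ (u i j + η * perp y i j) ^ 2 / η := by positivity
    rw [abs_le]
    constructor <;> linarith
  rw [abs_le] at h4 ⊢
  have hn' : (0 : ℝ) ≤ n := Nat.cast_nonneg n
  have h5 := mul_le_mul_of_nonneg_left h4.1 hn'
  have h6 := mul_le_mul_of_nonneg_left h4.2 hn'
  have e : (n / η + n) * entrySum u + n * η * sqSum (perp y)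
      = n * (entrySum u / η + η * sqSum (perp y)) + n * entrySum u := by ring
  rw [h3, e]
  have h7 : 0 ≤ (n : ℝ) * entrySum u := h1.trans h2
  constructor <;> linarith

variable {rate : Fin n → Fin n → unitInterval} {r : ℝ}

theorem mean_entrySum_arrivalMat (hr : ∀ i j, (rate i j : ℝ) = r) :
    mean (arrivalLaw rate) (fun a => entrySum (arrivalMat a)) = r * n ^ 2 := by
  have h := mean_arrival_affine hr fun _ _ : Fin n => 1
  simp only [one_mul] at h
  refine h.trans ?_
  simp only [entrySum, Finset.sum_const, Finset.card_univ, Fintype.card_fin, nsmul_eq_mul]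
  ring

/-- Any permutation matrix contributes `2 T - T = T`, where `T` is the entry sum of `x`, and uniform
arrivals contribute `r n T` on average; the schedule drops out. -/
theorem mean_marginInner (hn : n ≠ 0) (hr : ∀ i j, (rate i j : ℝ) = r) (x : Fin n → Fin n → ℝ)
    (s : Schedule n) :
    mean (arrivalLaw rate) (fun a => marginInner x (arrivalMat a - scheduleMat s))
      = (r * n - 1) * entrySum x := by
  have hn' : (n : ℝ) ≠ 0 := by exact_mod_cast hn
  have hp := finite_support_of_fintype (arrivalLaw rate)
  simp only [marginInner_eq_sum, Pi.sub_apply, mul_sub, Finset.sum_sub_distrib]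
  rw [mean_sub hp, mean_const, mean_arrival_affine hr, sum_mul_scheduleMat]
  simp only [entrySum, Finset.sum_sub_distrib, Finset.sum_add_distrib, Finset.sum_const,
    Finset.card_univ, Fintype.card_fin, nsmul_eq_mul, Equiv.sum_comp s (colSum x), sum_colSum,
    ← Finset.mul_sum, sum_rowSum]
  field_simp
  ring

/-- The constant term in the drift of the margin form. -/
theorem mean_marginForm (hn : n ≠ 0) (hr : ∀ i j, (rate i j : ℝ) = r) (s : Schedule n) :
    mean (arrivalLaw rate) (fun a => marginForm (arrivalMat a - scheduleMat s))
      = (2 * n - 1) * n * (r * (1 - r)) + n * (1 - r * n) ^ 2 := by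
  have hn' : (n : ℝ) ≠ 0 := by exact_mod_cast hn
  have hp := finite_support_of_fintype (arrivalLaw rate)
  have hrow : ∀ i, mean (arrivalLaw rate)
      (fun a => rowSum (arrivalMat a - scheduleMat s) i ^ 2)
      = r * (1 - r) * n + (r * n - 1) ^ 2 := by
    intro i
    have h := mean_sq_affine hr (fun k _ => if k = i then 1 else 0) 1
    have e1 : sqSum (fun k _ : Fin n => if k = i then (1 : ℝ) else 0) = n := by simp [sqSum]
    have e2 : entrySum (fun k _ : Fin n => if k = i then (1 : ℝ) else 0) = n := by
      simp [entrySum]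
    rw [e1, e2] at h
    rw [← h]
    congr 1
    funext a
    rw [rowSum_sub, rowSum_scheduleMat]
    simp [rowSum]
  have hcol : ∀ i, mean (arrivalLaw rate)
      (fun a => colSum (arrivalMat a - scheduleMat s) i ^ 2)
      = r * (1 - r) * n + (r * n - 1) ^ 2 := by
    intro i
    have h := mean_sq_affine hr (fun _ k => if k = i then 1 else 0) 1
    have e1 : sqSum (fun _ k : Fin n => if k = i then (1 : ℝ) else 0) = n := by simp [sqSum]
    have e2 : entrySum (fun _ k : Fin n => if k = i then (1 : ℝ) else 0) = n := by
      simp [entrySum]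
    rw [e1, e2] at h
    rw [← h]
    congr 1
    funext a
    rw [colSum_sub, colSum_scheduleMat]
    simp [colSum]
  have htot : mean (arrivalLaw rate)
      (fun a => entrySum (arrivalMat a - scheduleMat s) ^ 2)
      = r * (1 - r) * n ^ 2 + (r * n ^ 2 - n) ^ 2 := by
    have h := mean_sq_affine hr (fun _ _ => 1) n
    have e1 : sqSum (fun _ _ : Fin n => (1 : ℝ)) = n ^ 2 := by simp [sqSum, sq]
    have e2 : entrySum (fun _ _ : Fin n => (1 : ℝ)) = n ^ 2 := by simp [entrySum, sq]
    rw [e1, e2] at h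
    rw [← h]
    congr 1
    funext a
    rw [entrySum_sub, entrySum_scheduleMat]
    simp [entrySum]
  simp only [marginForm, div_eq_inv_mul]
  rw [mean_sub hp, mean_add hp, mean_finsetSum hp, mean_finsetSum hp, mean_mul_left, htot,
    Finset.sum_congr rfl fun i _ => hrow i, Finset.sum_congr rfl fun i _ => hcol i]
  simp only [Finset.sum_const, Finset.card_univ, Fintype.card_fin, nsmul_eq_mul]
  field_simp
  ring

variable {policy : QueueState n → PMF (Schedule n)}

/-- One step of the margin form: the drift is determined by the total queue length up to an error
governed by the unused service and by the component orthogonal to the margins. -/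
theorem marginForm_drift (hn : n ≠ 0) (hr : ∀ i j, (rate i j : ℝ) = r) {η : ℝ} (hη : 0 < η)
    (q : QueueState n) :
    |mean (step rate policy q) (fun q' => marginForm (queueMat q')) - marginForm (queueMat q)
        + 2 * (1 - r * n) * entrySum (queueMat q)
        - ((2 * n - 1) * n * (r * (1 - r)) + n * (1 - r * n) ^ 2)|
      ≤ (n / η + n) * (mean (step rate policy q) (fun q' => entrySum (queueMat q'))
          - entrySum (queueMat q) + n * (1 - r * n))
        + n * η * mean (step rate policy q) (fun q' => sqSum (perp (queueMat q'))) := by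
  have hp := finite_support_of_fintype (arrivalLaw rate)
  have hK := finite_support_step rate policy q
  set b : ℝ := n / η + n with hb
  set c : ℝ := n * η with hc
  set v : ℝ := (2 * n - 1) * n * (r * (1 - r)) + n * (1 - r * n) ^ 2 with hv
  have hZ : ∀ s, mean (arrivalLaw rate) (fun a => marginForm (queueMat q)
      + 2 * marginInner (queueMat q) (arrivalMat a - scheduleMat s)
      + marginForm (arrivalMat a - scheduleMat s))
      = marginForm (queueMat q) + 2 * ((r * n - 1) * entrySum (queueMat q)) + v := by
    intro s
    rw [mean_add hp, mean_add hp, mean_const, mean_mul_left, mean_marginInner hn hr,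
      mean_marginForm hn hr]
  have hU : mean (arrivalLaw rate) (fun a => b * (n - entrySum (queueMat q)
      - entrySum (arrivalMat a))) = b * (n - entrySum (queueMat q) - r * n ^ 2) := by
    rw [mean_mul_left, mean_sub hp, mean_const, mean_entrySum_arrivalMat hr]
  -- The error terms in the next state are moved inside the mean, so that the bound for each
  -- schedule no longer depends on `s` and `mean_step_le` applies; `hlow` does the same with the
  -- opposite sign.
  have hup : mean (step rate policy q) (fun q' => marginForm (queueMat q')
      - (b * entrySum (queueMat q') + c * sqSum (perp (queueMat q'))))
      ≤ marginForm (queueMat q) + 2 * ((r * n - 1) * entrySum (queueMat q)) + v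
        + b * (n - entrySum (queueMat q) - r * n ^ 2) := by
    refine mean_step_le fun s _ => ?_
    rw [← hZ s, ← hU, ← mean_add hp]
    refine mean_mono hp fun a _ => ?_
    have h1 := (abs_le.1 (abs_idle_le hn q a s hη)).2
    rw [entrySum_idleMat] at h1
    rw [marginForm_next]
    linarith
  have hlow : mean (step rate policy q) (fun q' => (-1) * marginForm (queueMat q')
      - (b * entrySum (queueMat q') + c * sqSum (perp (queueMat q'))))
      ≤ (-1) * (marginForm (queueMat q) + 2 * ((r * n - 1) * entrySum (queueMat q)) + v)
        + b * (n - entrySum (queueMat q) - r * n ^ 2) := by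
    refine mean_step_le fun s _ => ?_
    rw [← hZ s, ← hU, ← mean_mul_left, ← mean_add hp]
    refine mean_mono hp fun a _ => ?_
    have h1 := (abs_le.1 (abs_idle_le hn q a s hη)).1
    rw [entrySum_idleMat] at h1
    rw [marginForm_next]
    linarith
  rw [mean_sub hK, mean_add hK, mean_mul_left, mean_mul_left] at hup
  rw [mean_sub hK, mean_add hK, mean_mul_left, mean_mul_left, mean_mul_left] at hlow
  rw [abs_le]
  constructor <;> linarith

end MarginDrift

/-! ### Steady state of the switch -/

section Limit

variable {n : ℕ}

theorem summable_of_lmean_le {p : PMF (QueueState n)} {f : QueueState n → ℝ} (hf : ∀ q, 0 ≤ f q)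
    {B : ℝ} (h : lmean p (fun q => ENNReal.ofReal (f q)) ≤ ENNReal.ofReal B) (hB : 0 ≤ B) :
    (Summable fun q => (p q).toReal * f q) ∧ mean p f ≤ B := by
  have hs : Summable fun q => (p q).toReal * f q := by
    refine (ENNReal.summable_toReal (ne_top_of_le_ne_top ENNReal.ofReal_ne_top h)).congr
      fun q => ?_
    rw [ENNReal.toReal_mul, ENNReal.toReal_ofReal (hf q)]
  refine ⟨hs, ?_⟩
  rw [← ofReal_mean p hf hs] at h
  exact (ENNReal.ofReal_le_ofReal_iff hB).1 h

theorem totalQueue_nonneg (q : QueueState n) : 0 ≤ totalQueue q :=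
  Finset.sum_nonneg fun _ _ => Finset.sum_nonneg fun _ _ => Nat.cast_nonneg _

theorem totalQueue_le_sqSum (q : QueueState n) : totalQueue q ≤ sqSum (queueMat q) :=
  Finset.sum_le_sum fun i _ => Finset.sum_le_sum fun j _ => by
    simp only [queueMat]
    exact_mod_cast Nat.le_self_pow two_ne_zero (q i j)

theorem integrable_of_lmean {p : PMF (QueueState n)} {f : QueueState n → ℝ} (hf : ∀ q, 0 ≤ f q)
    (h : lmean p (fun q => ENNReal.ofReal (f q)) ≠ ⊤) : Integrable f p.toMeasure := by
  refine ⟨(Measurable.of_discrete).aestronglyMeasurable, ?_⟩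
  rw [hasFiniteIntegral_iff_ofReal (Eventually.of_forall hf), lintegral_toMeasure]
  exact h.lt_top

variable {rate : Fin n → Fin n → unitInterval} {r : ℝ} {policy : QueueState n → PMF (Schedule n)}

/-- The moment bounds come with the constructed law; `IsSteadyState.unique` makes them available for
any given steady state. -/
theorem exists_steadyState_step (hn : n ≠ 0) (hr : ∀ i j, (rate i j : ℝ) = r) (hr1 : r * n < 1)
    (hr2 : r < 1) (hpolicy : IsMaxWeight policy) :
    ∃ p, IsSteadyState (step rate policy) p ∧
      ∀ (W : QueueState n → ℝ) (δ C c : ℝ), 0 < δ → 0 ≤ C → 0 ≤ c →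
      RootDrift (step rate policy) W δ C c →
      lmean p (fun q => ENNReal.ofReal (W q)) ≤ ENNReal.ofReal (driftBound δ C c) := by
  have hn' : (0 : ℝ) < n := by exact_mod_cast hn.bot_lt
  refine exists_steadyState (finite_support_step rate policy) ?_ ?_ ?_
    (rootDrift_sqSum hn hr hr1.le hpolicy) finite_sqSum_le (x₀ := 0)
    (h := fun q => ∑ i, ∑ j, q i j) (step_zero hr hr2) (exists_step_lt hr hr2 hpolicy)
  · exact div_pos (by linarith) hn'
  · positivity
  · positivity

theorem lmean_sqSum_ne_top (hn : n ≠ 0) (hr : ∀ i j, (rate i j : ℝ) = r) (hr1 : r * n < 1)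
    (hr2 : r < 1) (hpolicy : IsMaxWeight policy) {p : PMF (QueueState n)}
    (hp : IsSteadyState (step rate policy) p) :
    lmean p (fun q => ENNReal.ofReal (sqSum (queueMat q))) ≠ ⊤ := by
  have hn' : (0 : ℝ) < n := by exact_mod_cast hn.bot_lt
  obtain ⟨p', hp', hmom⟩ := exists_steadyState_step hn hr hr1 hr2 hpolicy
  obtain rfl := hp.unique hp'
  exact ne_top_of_le_ne_top ENNReal.ofReal_ne_top (hmom _ _ _ _ (div_pos (by linarith) hn')
    (by positivity) (by positivity) (rootDrift_sqSum hn hr hr1.le hpolicy))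

theorem integrable_totalQueue (hn : n ≠ 0) (hr : ∀ i j, (rate i j : ℝ) = r) (hr1 : r * n < 1)
    (hr2 : r < 1) (hpolicy : IsMaxWeight policy) {p : PMF (QueueState n)}
    (hp : IsSteadyState (step rate policy) p) : Integrable totalQueue p.toMeasure := by
  refine integrable_of_lmean totalQueue_nonneg ?_
  refine ne_top_of_le_ne_top (lmean_sqSum_ne_top hn hr hr1 hr2 hpolicy hp) (lmean_mono p fun q => ?_)
  exact ENNReal.ofReal_le_ofReal (totalQueue_le_sqSum q)

/-- A bound, uniform in the load, for the mean of the squared component orthogonal to the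
margins. -/
def perpBound (n : ℕ) : ℝ := driftBound (1 / n ^ 3) (n ^ 2) (8 * n ^ 2 + 2 * (n ^ 2) ^ 2)

/-- The mean total queue length in steady state, up to an error that is small in heavy traffic. -/
theorem abs_mean_totalQueue_sub_le (hn : n ≠ 0) (hr : ∀ i j, (rate i j : ℝ) = r)
    (hr0 : 1 ≤ 2 * (r * n)) (hr1 : r * n < 1) (hr2 : r < 1) (hpolicy : IsMaxWeight policy)
    {p : PMF (QueueState n)} (hp : IsSteadyState (step rate policy) p) {η : ℝ} (hη : 0 < η) :
    |2 * (1 - r * n) * mean p totalQueue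
        - ((2 * n - 1) * n * (r * (1 - r)) + n * (1 - r * n) ^ 2)|
      ≤ (n / η + n) * (n * (1 - r * n)) + n * η * perpBound n := by
  have hn' : (0 : ℝ) < n := by exact_mod_cast hn.bot_lt
  have hK := finite_support_step rate policy
  have hS := lmean_sqSum_ne_top hn hr hr1 hr2 hpolicy hp
  have hdom : ∀ f : QueueState n → ℝ, (∀ q, f q ≤ sqSum (queueMat q)) →
      lmean p (fun q => ENNReal.ofReal (f q)) ≠ ⊤ := fun f hf =>
    ne_top_of_le_ne_top hS (lmean_mono p fun q => ENNReal.ofReal_le_ofReal (hf q))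
  obtain ⟨hT, hPT, eT⟩ := mean_step_of_stationary hK hp.stationary
    (f := fun q => entrySum (queueMat q)) totalQueue_nonneg (hdom _ totalQueue_le_sqSum)
  obtain ⟨hW, hPW, eW⟩ := mean_step_of_stationary hK hp.stationary
    (f := fun q => sqSum (perp (queueMat q))) (fun q => sqSum_nonneg _)
    (hdom _ fun q => sqSum_perp_le _)
  have hVtop : lmean p (fun q => ENNReal.ofReal (marginForm (queueMat q))) ≠ ⊤ := by
    have h1 : lmean p (fun q => ENNReal.ofReal (marginForm (queueMat q)))
        ≤ n * lmean p (fun q => ENNReal.ofReal (sqSum (queueMat q))) := by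
      rw [lmean, lmean, ← ENNReal.tsum_mul_left]
      refine ENNReal.tsum_le_tsum fun q => ?_
      rw [mul_left_comm]
      refine mul_le_mul_right ?_ _
      rw [← ENNReal.ofReal_natCast, ← ENNReal.ofReal_mul (Nat.cast_nonneg n)]
      exact ENNReal.ofReal_le_ofReal (marginForm_le hn _)
    exact ne_top_of_le_ne_top (ENNReal.mul_ne_top (ENNReal.natCast_ne_top n) hS) h1
  obtain ⟨hV, hPV, eV⟩ := mean_step_of_stationary hK hp.stationary
    (f := fun q => marginForm (queueMat q)) (fun q => marginForm_nonneg hn _) hVtop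
  have hWle : mean p (fun q => sqSum (perp (queueMat q))) ≤ perpBound n := by
    obtain ⟨p', hp', hmom⟩ := exists_steadyState_step hn hr hr1 hr2 hpolicy
    obtain rfl := hp.unique hp'
    have hr0' : 0 ≤ r := by
      by_contra h
      push Not at h
      have := mul_neg_of_neg_of_pos h hn'
      linarith
    -- From `r n ≥ 1/2`; this gives a drift coefficient that does not depend on the load.
    have hδ : 1 / (n : ℝ) ^ 3 ≤ 2 * r / n ^ 2 := by
      rw [div_le_div_iff₀ (by positivity) (by positivity)]
      have : 2 * r * (n : ℝ) ^ 3 = 2 * (r * n) * n ^ 2 := by ring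
      rw [this]
      exact mul_le_mul_of_nonneg_right hr0 (by positivity)
    refine (summable_of_lmean_le (fun q => sqSum_nonneg _) (hmom _ _ _ _ ?_ ?_ ?_
      (rootDrift_perp hn hr hr0' hr2.le hpolicy hδ)) (driftBound_nonneg ?_ ?_)).2 <;> positivity
  set b : ℝ := n / η + n
  set c : ℝ := n * η with hc
  set v : ℝ := (2 * n - 1) * n * (r * (1 - r)) + n * (1 - r * n) ^ 2
  set mT := mean p totalQueue with hmT
  set mW := mean p (fun q => sqSum (perp (queueMat q)))
  set mV := mean p (fun q => marginForm (queueMat q))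
  have sT : HasSum (fun q => (p q).toReal * entrySum (queueMat q)) mT := hT.hasSum
  have sPT := hPT.hasSum
  change HasSum _ (mean p _) at sPT
  rw [eT] at sPT
  change HasSum _ mT at sPT
  have sPW := hPW.hasSum
  change HasSum _ (mean p _) at sPW
  rw [eW] at sPW
  have sV : HasSum (fun q => (p q).toReal * marginForm (queueMat q)) mV := hV.hasSum
  have sPV := hPV.hasSum
  change HasSum _ (mean p _) at sPV
  rw [eV] at sPV
  have s1 : HasSum (fun q => (p q).toReal) 1 := tsum_toReal p ▸ (summable_toReal p).hasSum
  have hdrift := marginForm_drift (policy := policy) hn hr hη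
  -- Averaging `marginForm_drift` over `p`: the differences `mV - mV` and `mT - mT` cancel, leaving
  -- `n (1 - r n)` as the mean unused service.
  have sA := ((sPV.sub sV).add (sT.mul_left (2 * (1 - r * n)))).sub (s1.mul_left v)
  have sB := (((sPT.sub sT).add (s1.mul_left (n * (1 - r * n)))).mul_left b).add (sPW.mul_left c)
  have h1 := hasSum_le (fun q => ?_) sA sB
  have h2 := hasSum_le (fun q => ?_) sB.neg sA
  · have h3 : c * mW ≤ c * perpBound n :=
      mul_le_mul_of_nonneg_left hWle (by positivity)
    rw [abs_le]
    constructor <;> linarith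
  · have h3 := mul_le_mul_of_nonneg_left (abs_le.1 (hdrift q)).1
      (ENNReal.toReal_nonneg (a := p q))
    linarith
  · have h3 := mul_le_mul_of_nonneg_left (abs_le.1 (hdrift q)).2
      (ENNReal.toReal_nonneg (a := p q))
    linarith

theorem uniformRate_apply (ε : Set.Ioo (0 : ℝ) 1) (i j : Fin n) :
    (uniformRate n ε i j : ℝ) = (1 - (ε : ℝ)) / n := rfl

end Limit

end Switch

end

/-! ### The heavy-traffic limit -/

theorem mainTheorem10 (n : ℕ) (hn : 1 ≤ n)
    (policy : Switch.QueueState n → PMF (Switch.Schedule n))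
    (hpolicy : Switch.IsMaxWeight policy) :
    (∀ ε : Set.Ioo (0 : ℝ) 1, ∃! p : PMF (Switch.QueueState n),
      Switch.IsSteadyState (Switch.step (Switch.uniformRate n ε) policy) p) ∧
    ∀ p : Set.Ioo (0 : ℝ) 1 → PMF (Switch.QueueState n),
      (∀ ε, Switch.IsSteadyState (Switch.step (Switch.uniformRate n ε) policy) (p ε)) →
      (∀ ε, Integrable Switch.totalQueue (p ε).toMeasure) ∧
      Tendsto (fun ε : Set.Ioo (0 : ℝ) 1 =>
          (ε : ℝ) * ∫ q, Switch.totalQueue q ∂(p ε).toMeasure)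
        (comap ((↑) : Set.Ioo (0 : ℝ) 1 → ℝ) (𝓝[>] (0 : ℝ)))
        (𝓝 ((2 * (n : ℝ) - 1) / 2 * (1 - 1 / (n : ℝ)))) := by
  have hn0 : n ≠ 0 := by omega
  have hn1 : (1 : ℝ) ≤ n := by exact_mod_cast hn
  have hn' : (n : ℝ) ≠ 0 := by positivity
  have hrn : ∀ ε : ℝ, (1 - ε) / n * n = 1 - ε := fun ε => div_mul_cancel₀ _ hn'
  have hlt : ∀ ε : Set.Ioo (0 : ℝ) 1, (1 - (ε : ℝ)) / n * n < 1 := fun ε => by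
    rw [hrn]
    linarith [ε.2.1]
  have hlt' : ∀ ε : Set.Ioo (0 : ℝ) 1, (1 - (ε : ℝ)) / n < 1 := fun ε => by
    rw [div_lt_one (by linarith)]
    linarith [ε.2.1]
  refine ⟨fun ε => ?_, fun p hp => ?_⟩
  · obtain ⟨p, hp, _⟩ := Switch.exists_steadyState_step hn0 (Switch.uniformRate_apply ε) (hlt ε)
      (hlt' ε) hpolicy
    exact ⟨p, hp, fun p' hp' => hp'.unique hp⟩
  · have hint := fun ε => Switch.integrable_totalQueue hn0 (Switch.uniformRate_apply ε) (hlt ε)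
      (hlt' ε) hpolicy (hp ε)
    refine ⟨hint, ?_⟩
    let v : ℝ → ℝ := fun e => (2 * n - 1) * n * ((1 - e) / n * (1 - (1 - e) / n)) + n * e ^ 2
    let err : ℝ → ℝ := fun e => n ^ 2 * √e + n ^ 2 * e + n * √e * Switch.perpBound n
    have hbound : ∀ ε : Set.Ioo (0 : ℝ) 1, (ε : ℝ) < 1 / 2 →
        |2 * ((ε : ℝ) * ∫ q, Switch.totalQueue q ∂(p ε).toMeasure) - v ε| ≤ err ε := by
      intro ε hε
      have hpos : 0 < √(ε : ℝ) := Real.sqrt_pos.2 ε.2.1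
      -- The choice `η = √ε` makes both `n² ε / η` and `n η` of order `√ε`; the condition `ε < 1/2`
      -- gives `r n ≥ 1/2`.
      have h := Switch.abs_mean_totalQueue_sub_le hn0 (Switch.uniformRate_apply ε)
        (by rw [hrn]; linarith) (hlt ε) (hlt' ε) hpolicy (hp ε) hpos
      rw [Switch.integral_toMeasure _ (hint ε)]
      rw [hrn, sub_sub_cancel] at h
      have e : (n / √(ε : ℝ) + n) * (n * (ε : ℝ)) = n ^ 2 * √(ε : ℝ) + n ^ 2 * (ε : ℝ) := by
        have h1 : (ε : ℝ) / √(ε : ℝ) = √(ε : ℝ) := Real.div_sqrt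
        calc _ = (n : ℝ) ^ 2 * ((ε : ℝ) / √(ε : ℝ)) + n ^ 2 * (ε : ℝ) := by ring
          _ = _ := by rw [h1]
      rw [e, mul_assoc 2] at h
      exact h
    have hcoe : Tendsto ((↑) : Set.Ioo (0 : ℝ) 1 → ℝ)
        (comap ((↑) : Set.Ioo (0 : ℝ) 1 → ℝ) (𝓝[>] (0 : ℝ))) (𝓝 0) :=
      tendsto_comap.mono_right nhdsWithin_le_nhds
    have hv : Tendsto (fun ε : Set.Ioo (0 : ℝ) 1 => v ε)
        (comap ((↑) : Set.Ioo (0 : ℝ) 1 → ℝ) (𝓝[>] (0 : ℝ))) (𝓝 (v 0)) :=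
      ((by fun_prop : Continuous v).tendsto 0).comp hcoe
    have herr : Tendsto (fun ε : Set.Ioo (0 : ℝ) 1 => err ε)
        (comap ((↑) : Set.Ioo (0 : ℝ) 1 → ℝ) (𝓝[>] (0 : ℝ))) (𝓝 0) := by
      have h := ((by fun_prop : Continuous err).tendsto 0).comp hcoe
      have e : err 0 = 0 := by simp [err]
      rwa [e] at h
    have hdiff : Tendsto (fun ε : Set.Ioo (0 : ℝ) 1 =>
        2 * ((ε : ℝ) * ∫ q, Switch.totalQueue q ∂(p ε).toMeasure) - v ε)
        (comap ((↑) : Set.Ioo (0 : ℝ) 1 → ℝ) (𝓝[>] (0 : ℝ))) (𝓝 0) := by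
      refine squeeze_zero_norm' ?_ herr
      filter_upwards [hcoe.eventually_lt_const (by norm_num : (0 : ℝ) < 1 / 2)] with ε hε
      exact hbound ε hε
    have hlim := (hdiff.add hv).const_mul (1 / 2)
    -- At `ε = 0` the rate is `1 / n`, so `v 0 = (2 n - 1) (1 - 1 / n)`.
    have e : 1 / 2 * (0 + v 0) = (2 * (n : ℝ) - 1) / 2 * (1 - 1 / (n : ℝ)) := by
      simp only [v]
      field_simp
      ring
    rw [e] at hlim
    refine hlim.congr fun ε => ?_
    ring
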